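/- Let $l\in\mathbb N$ and let $C=C([0,1];\mathbb R^l)$ carry the $\sigma$-algebra generated by the canonical process $X_t(\omega)=\omega(t)$. For $n\ge 1$ let $\mathcal F^n=\sigma(X_{k/n}:k=0,\dots,n)$. For probability measures $\mathbb Q,\mathbb P$ on $C$ let $H(\mathbb Q|\mathbb P)|_{\mathcal F^n}=\int\log\frac{d\mathbb Q|_{\mathcal F^n}}{d\mathbb P|_{\mathcal F^n}}\,d\mathbb Q$ if $\mathbb Q|_{\mathcal F^n}\ll\mathbb P|_{\mathcal F^n}$ and $H(\mathbb Q|\mathbb P)|_{\mathcal F^n}=+\infty$ otherwise, and define the specific relative entropy $$h_l(\mathbb Q|\mathbb P)=\liminf_{n\to\infty}2^{-n}H(\mathbb Q|\mathbb P)|_{\mathcal F^{2^n}}.$$ For $\Gamma\in\mathbb R^{l\times l}$ and $x\in\mathbb R^l$, an $l$-dimensional martingale Black–Scholes model $M^\Gamma$ with parameter $\Gamma$ started at $x$ is a continuous adapted solution on $[0,1]$ of $$dM^\Gamma_t=\operatorname{diag}(M^\Gamma_t)\,\Gamma\,dB_t,\qquad M^\Gamma_0=x,$$ where $B$ is a standard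 $\mathbb R^l$-valued Brownian motion. Let $\Gamma_1,\Gamma_2\in\mathbb R^{l\times l}$ with $\Gamma_2$ invertible, and let $M^{\Gamma_1},M^{\Gamma_2}$ be martingale Black–Scholes models (possibly on different probability spaces) with parameters $\Gamma_1,\Gamma_2$, started at the same point $x$, all of whose coordinates are nonzero. Then their laws on $C$ satisfy $$h_l\big(\mathcal L(M^{\Gamma_1})\,\big|\,\mathcal L(M^{\Gamma_2})\big)=\frac12\Big(\operatorname{tr}\big((\Gamma_2\Gamma_2^T)^{-1}\Gamma_1\Gamma_1^T\big)-l-\log\frac{\det(\Gamma_1\Gamma_1^T)}{\det(\Gamma_2\Gamma_2^T)}\Big),$$ where the right-hand side is read as $+\infty$ (that is, $\log 0=-\infty$) if $\Gamma_1$ is singular. -/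

import Mathlib

open MeasureTheory ProbabilityTheory Filter
open scoped ENNReal unitInterval

noncomputable section

/-- The Wiener space `C([0,1]; ℝ^l)` of continuous paths. -/
abbrev PathSpace (l : ℕ) : Type := C(I, Fin l → ℝ)

/-- The σ-algebra on the path space generated by the canonical process `X_t(ω) = ω(t)`. -/
instance PathSpace.instMeasurableSpace (l : ℕ) : MeasurableSpace (PathSpace l) :=
  ⨆ t : I, MeasurableSpace.comap (fun ω : PathSpace l => ω t) inferInstance

/-- The time `k / n` in `[0,1]`, for `k = 0, …, n`. -/
def gridPoint (n : ℕ) (k : Fin (n + 1)) : I :=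
  ⟨(k : ℝ) / (n : ℝ), by positivity,
    div_le_one_of_le₀ (by exact_mod_cast Nat.lt_succ_iff.mp k.isLt) (by positivity)⟩

/-- The σ-algebra `𝓕ⁿ = σ(X_{k/n} : k = 0, …, n)`. -/
abbrev gridSigma (l n : ℕ) : MeasurableSpace (PathSpace l) :=
  ⨆ k : Fin (n + 1),
    MeasurableSpace.comap (fun ω : PathSpace l => ω (gridPoint n k)) inferInstance

theorem gridSigma_le (l n : ℕ) : gridSigma l n ≤ PathSpace.instMeasurableSpace l :=
  iSup_le fun k => le_iSup
    (fun t : I => MeasurableSpace.comap (fun ω : PathSpace l => ω t) inferInstance)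
    (gridPoint n k)

/-- The relative entropy `H(ℚ|ℙ)` of the restrictions of `ℚ` and `ℙ` to `𝓕ⁿ`. For probability
measures `klDiv` is `∫ log (dℚ/dℙ) dℚ` under absolute continuity, and `∞` otherwise. -/
def gridEntropy {l : ℕ} (Q P : Measure (PathSpace l)) (n : ℕ) : ℝ≥0∞ :=
  InformationTheory.klDiv (Q.trim (gridSigma_le l n)) (P.trim (gridSigma_le l n))

/-- The specific relative entropy `h_l(ℚ|ℙ) = liminf_n 2⁻ⁿ H(ℚ|ℙ)|_{𝓕^{2ⁿ}}`. -/
def specificRelEntropy {l : ℕ} (Q P : Measure (PathSpace l)) : ℝ≥0∞ :=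
  liminf (fun n : ℕ => ((2 : ℝ≥0∞) ^ n)⁻¹ * gridEntropy Q P (2 ^ n)) atTop

/-- `B` is a standard `ℝ^l`-valued Brownian motion on `[0,1]` with respect to the filtration `𝓕`:
it is adapted, starts at `0`, has a.s. continuous paths, and for `s ≤ t` the increment
`B_t - B_s` is independent of `𝓕_s` with law `N(0, (t - s) Id)`. -/
structure IsBrownianMotion {l : ℕ} {Ω : Type*} {mΩ : MeasurableSpace Ω}
    (P : Measure Ω) (𝓕 : Filtration I mΩ) (B : I → Ω → Fin l → ℝ) : Prop where
  adapted : ∀ t, Measurable[𝓕 t] (B t)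
  zero : ∀ᵐ ω ∂P, B 0 ω = 0
  cont : ∀ᵐ ω ∂P, Continuous fun t => B t ω
  indep : ∀ s t, s ≤ t →
    Indep (MeasurableSpace.comap (fun ω => B t ω - B s ω) inferInstance) (𝓕 s) P
  law : ∀ s t, s ≤ t →
    HasLaw (fun ω => B t ω - B s ω)
      (Measure.pi fun _ : Fin l => gaussianReal 0 (Real.toNNReal ((t : ℝ) - (s : ℝ)))) P

/-- `J` is the Itô integral process `∫₀ᵗ H dB`, `t ∈ [0,1]`, of a continuous adapted
matrix-valued integrand `H` against the Brownian motion `B`: for every `t` and every sequence of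
partitions `0 = π₀ ≤ π₁ ≤ ⋯ ≤ π_N = t` whose mesh tends to zero, the non-anticipating
(left-endpoint) sums `∑_j H_{π_j} (B_{π_{j+1}} - B_{π_j})` converge to `J_t` in probability. -/
def IsItoIntegral {l : ℕ} {Ω : Type*} {mΩ : MeasurableSpace Ω} (P : Measure Ω)
    (H : I → Ω → Matrix (Fin l) (Fin l) ℝ) (B J : I → Ω → Fin l → ℝ) : Prop :=
  ∀ (t : I) (N : ℕ → ℕ) (π : ℕ → ℕ → I),
    (∀ n, Monotone (π n)) → (∀ n, π n 0 = 0) → (∀ n, π n (N n) = t) →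
    (∀ ε : ℝ, 0 < ε → ∀ᶠ n in atTop, ∀ j < N n, ((π n (j + 1) : I) : ℝ) - (π n j : ℝ) < ε) →
    TendstoInMeasure P
      (fun n ω => ∑ j ∈ Finset.range (N n),
        (H (π n j) ω).mulVec (B (π n (j + 1)) ω - B (π n j) ω))
      atTop (J t)

/-- `M` is an `l`-dimensional martingale Black–Scholes model with parameter `Γ`, started at `x`:
a continuous adapted solution on `[0,1]` of `dM_t = diag(M_t) Γ dB_t`, `M_0 = x`, where `B` is a
standard Brownian motion for the filtration `𝓕`. -/
structure IsBlackScholesModel {l : ℕ} {Ω : Type*} {mΩ : MeasurableSpace Ω}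
    (P : Measure Ω) (𝓕 : Filtration I mΩ) (B : I → Ω → Fin l → ℝ)
    (Γ : Matrix (Fin l) (Fin l) ℝ) (x : Fin l → ℝ) (M : Ω → PathSpace l) : Prop where
  brownian : IsBrownianMotion P 𝓕 B
  adapted : ∀ t, Measurable[𝓕 t] fun ω => M ω t
  init : ∀ᵐ ω ∂P, M ω 0 = x
  sde : IsItoIntegral P (fun t ω => Matrix.diagonal (M ω t) * Γ) B (fun t ω => M ω t - x)

end

/-! Each coordinate of the model solves a scalar equation `dM = M dW`, where `W = (ΓB)_i` is a
Brownian motion of variance `c = ∑ j, Γ i j ^ 2` per unit time. Its solution is geometric Brownian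
motion, so the logarithmic returns over a dyadic grid are i.i.d. Gaussian. As the coordinates of `x`
are nonzero, prices and returns determine each other. Additivity of relative entropy then produces
`2 ^ n` times the one-step entropy, which the normalisation cancels. It remains to compute the
divergence of two Gaussian laws over a step of length `v = 2⁻ⁿ`. Their means differ by a quantity of
order `v`, their covariances are of order `v`, so the mean contributes `O(v)` and disappears in the
limit, while the covariance part does not depend on `n`. If `Γ₁` is singular, the first law sits on
a hyperplane that the second does not charge, and every term is infinite.

The Itô integral is only a limit in probability of Riemann sums, and no moments of `M` are assumed,
so identifying `M` takes most of the stochastic work. The exponential martingale is shown to satisfy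
the same Riemann sum relation with an explicit mean-square error
(`integral_sq_expMartingale_error_le`). The difference of the two solutions is localised to be
bounded and killed by a Picard-type iteration on second moments (`eq_mul_expMartingale_of_bounded`).
The entropy side rests on `klDiv_pi_fin`, `klDiv_logReturnLaw` and
`klDiv_map_mulVec_add_pi_gaussianReal`. -/

section Orthogonality

/-! ### Discrete Itô isometry -/

variable {Ω : Type*} {mΩ : MeasurableSpace Ω} {P : Measure Ω}

theorem IndepFun.memLp_two_mul {X Y : Ω → ℝ} (h : IndepFun X Y P)
    (hX : MemLp X 2 P) (hY : MemLp Y 2 P) : MemLp (fun ω => X ω * Y ω) 2 P := by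
  refine (memLp_two_iff_integrable_sq (hX.1.mul hY.1)).2 ?_
  have h2 : IndepFun (fun ω => X ω ^ 2) (fun ω => Y ω ^ 2) P :=
    h.comp (φ := fun x : ℝ => x ^ 2) (ψ := fun x : ℝ => x ^ 2) (by fun_prop) (by fun_prop)
  refine (h2.integrable_mul hX.integrable_sq hY.integrable_sq).congr ?_
  filter_upwards with ω
  simp [mul_pow]

/-- The square of a discrete stochastic integral has expectation equal to the sum of the
expectations of the squares of its terms. -/
theorem memLp_and_integral_sq_sum_mul [IsProbabilityMeasure P] (𝒢 : ℕ → MeasurableSpace Ω)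
    (hle : ∀ n, 𝒢 n ≤ mΩ) (hmono : Monotone 𝒢) (H X : ℕ → Ω → ℝ)
    (hH : ∀ n, Measurable[𝒢 n] (H n)) (hX : ∀ n, Measurable[𝒢 (n + 1)] (X n))
    (hind : ∀ n, Indep (MeasurableSpace.comap (X n) inferInstance) (𝒢 n) P)
    (hH2 : ∀ n, MemLp (H n) 2 P) (hX2 : ∀ n, MemLp (X n) 2 P)
    (hX0 : ∀ n, ∫ ω, X n ω ∂P = 0) (n : ℕ) :
    Measurable[𝒢 n] (fun ω => ∑ j ∈ Finset.range n, H j ω * X j ω) ∧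
    MemLp (fun ω => ∑ j ∈ Finset.range n, H j ω * X j ω) 2 P ∧
    ∫ ω, (∑ j ∈ Finset.range n, H j ω * X j ω) ^ 2 ∂P =
      ∑ j ∈ Finset.range n, (∫ ω, H j ω ^ 2 ∂P) * ∫ ω, X j ω ^ 2 ∂P := by
  induction n with
  | zero => simp
  | succ n ih =>
    obtain ⟨hm, hL, hI⟩ := ih
    have hindf : ∀ Z : Ω → ℝ, Measurable[𝒢 n] Z → IndepFun Z (X n) P := fun Z hZ =>
      (IndepFun_iff_Indep _ _ _).2 (indep_of_indep_of_le_right (hind n) hZ.comap_le).symm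
    have hHX : MemLp (fun ω => H n ω * X n ω) 2 P :=
      IndepFun.memLp_two_mul (hindf _ (hH n)) (hH2 n) (hX2 n)
    simp only [Finset.sum_range_succ]
    refine ⟨?_, hL.add hHX, ?_⟩
    · refine Measurable.fun_add ?_ ?_
      · exact hm.mono (hmono n.le_succ) le_rfl
      · exact Measurable.fun_mul
          ((hH n).mono (hmono n.le_succ) le_rfl) (hX n)
    · set S : Ω → ℝ := fun ω => ∑ j ∈ Finset.range n, H j ω * X j ω with hS
      have hSH : Measurable[𝒢 n] (fun ω => S ω * H n ω) :=
        Measurable.fun_mul hm (hH n)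
      have hcross : Integrable (fun ω => S ω * (H n ω * X n ω)) P :=
        hL.integrable_mul hHX
      -- The cross term vanishes: `S * H n` is known at stage `n`, hence independent of the centred
      -- `X n`.
      have e0 : ∫ ω, S ω * (H n ω * X n ω) ∂P = 0 := by
        have := (hindf _ hSH).integral_fun_mul_eq_mul_integral
          ((hSH.mono (hle n) le_rfl).aestronglyMeasurable) (hX2 n).1
        rw [hX0 n, mul_zero] at this
        rw [← this]
        simp only [mul_assoc]
      have e1 : ∫ ω, (H n ω * X n ω) ^ 2 ∂P = (∫ ω, H n ω ^ 2 ∂P) * ∫ ω, X n ω ^ 2 ∂P := by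
        have h2 : IndepFun (fun ω => H n ω ^ 2) (fun ω => X n ω ^ 2) P :=
          (hindf _ (hH n)).comp (φ := fun x : ℝ => x ^ 2) (ψ := fun x : ℝ => x ^ 2)
            (by fun_prop) (by fun_prop)
        rw [← h2.integral_fun_mul_eq_mul_integral (hH2 n).integrable_sq.1
          (hX2 n).integrable_sq.1]
        simp only [mul_pow]
      have : ∀ ω, (S ω + H n ω * X n ω) ^ 2 =
          S ω ^ 2 + 2 * (S ω * (H n ω * X n ω)) + (H n ω * X n ω) ^ 2 := fun ω => by ring
      change ∫ ω, (S ω + H n ω * X n ω) ^ 2 ∂P = _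
      simp only [this]
      have i1 := hL.integrable_sq
      have i2 := hHX.integrable_sq
      rw [integral_add (i1.fun_add (hcross.const_mul 2)) i2, integral_add i1 (hcross.const_mul 2),
        integral_const_mul, e0, e1, hI]
      ring

end Orthogonality

/-! ### Exponential moments of centred Gaussians -/

section GaussianMoments

theorem integral_sq_gaussianReal_zero (v : NNReal) : ∫ z, z ^ 2 ∂gaussianReal 0 v = v := by
  have h := variance_fun_id_gaussianReal (μ := 0) (v := v)
  change Var[id; gaussianReal 0 v] = v at h
  rw [variance_eq_sub (memLp_id_gaussianReal 2)] at h
  simpa using h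

theorem integral_exp_mul_gaussianReal_zero (v : NNReal) (t : ℝ) :
    ∫ z, Real.exp (t * z) ∂gaussianReal 0 v = Real.exp (v * t ^ 2 / 2) := by
  have := congrFun (mgf_id_gaussianReal (μ := 0) (v := v)) t
  simpa [mgf] using this

theorem integral_mul_exp_gaussianReal_zero (v : NNReal) :
    ∫ z, z * Real.exp z ∂gaussianReal 0 v = v * Real.exp (v / 2) := by
  have h := deriv_mgf (X := id) (μ := gaussianReal 0 v) (t := 1)
    (by simp [integrableExpSet_id_gaussianReal])
  simp only [id, one_mul] at h
  rw [← h, mgf_id_gaussianReal]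
  have : HasDerivAt (fun t : ℝ => Real.exp (0 * t + v * t ^ 2 / 2))
      (Real.exp (0 * 1 + v * 1 ^ 2 / 2) * (0 * 1 + v * (2 * 1 ^ (2 - 1) * 1) / 2)) 1 := by
    refine HasDerivAt.exp ?_
    refine ((hasDerivAt_id 1).const_mul 0).add ?_
    exact (((hasDerivAt_id (1 : ℝ)).pow 2).const_mul (v : ℝ)).div_const 2
  rw [this.deriv]
  norm_num
  ring_nf

theorem memLp_exp_gaussianReal_zero (v : NNReal) :
    MemLp (fun z => Real.exp z) 2 (gaussianReal 0 v) := by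
  refine (memLp_two_iff_integrable_sq (by fun_prop)).2 ?_
  refine (integrable_exp_mul_gaussianReal (μ := 0) (v := v) 2).congr ?_
  filter_upwards with z
  rw [← Real.exp_nat_mul]; norm_num

/-- This function is the relative error made when one step of the exponential martingale is replaced
by its first-order term `z`. -/
theorem memLp_exp_error_gaussianReal (v : NNReal) :
    MemLp (fun z => Real.exp (z - v / 2) - 1 - z) 2 (gaussianReal 0 v) := by
  refine MemLp.sub (MemLp.sub ?_ (memLp_const 1)) (memLp_id_gaussianReal 2)
  have := (memLp_exp_gaussianReal_zero v).const_mul (Real.exp (-(v / 2)))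
  refine this.ae_eq ?_
  filter_upwards with z
  rw [← Real.exp_add]; ring_nf

theorem integral_exp_error_gaussianReal (v : NNReal) :
    ∫ z, (Real.exp (z - v / 2) - 1 - z) ∂gaussianReal 0 v = 0 := by
  have hi : Integrable (fun z => Real.exp (-(v / 2)) * Real.exp z) (gaussianReal 0 v) :=
    ((memLp_exp_gaussianReal_zero v).integrable (by norm_num)).const_mul _
  have hz : Integrable (fun z : ℝ => z) (gaussianReal 0 v) :=
    (memLp_id_gaussianReal 2 (μ := 0) (v := v)).integrable (by norm_num)
  have h1 := integral_exp_mul_gaussianReal_zero v 1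
  have e : ∀ z : ℝ, Real.exp (z - v / 2) = Real.exp (-(v / 2)) * Real.exp z := fun z => by
    rw [← Real.exp_add]; ring_nf
  simp only [one_mul] at h1
  simp only [e]
  rw [integral_sub (f := fun z => Real.exp (-(v / 2)) * Real.exp z - 1)
      (hi.sub (integrable_const 1)) hz, integral_sub hi (integrable_const 1),
    integral_const_mul, h1, ← Real.exp_add]
  have := integral_id_gaussianReal (μ := 0) (v := v)
  simp [this]

/-- The value is of order `v ^ 2`, one order below the variance `v` of the increment, so the errors
summed over a partition are of the order of its mesh. -/
theorem integral_sq_exp_error_gaussianReal (v : NNReal) :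
    ∫ z, (Real.exp (z - v / 2) - 1 - z) ^ 2 ∂gaussianReal 0 v = Real.exp v - 1 - v := by
  have hz2 : MemLp (fun z : ℝ => z) 2 (gaussianReal 0 v) := memLp_id_gaussianReal 2
  have he := memLp_exp_gaussianReal_zero v
  have h1 := integral_exp_mul_gaussianReal_zero v 1
  have h2 := integral_exp_mul_gaussianReal_zero v 2
  have h3 := integral_mul_exp_gaussianReal_zero v
  have h4 := integral_sq_gaussianReal_zero v
  have h5 := integral_id_gaussianReal (μ := 0) (v := v)
  simp only [one_mul] at h1
  set c := Real.exp (-(v / 2 : ℝ)) with hc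
  have e : ∀ z : ℝ, (Real.exp (z - v / 2) - 1 - z) ^ 2 =
      c ^ 2 * Real.exp (2 * z) + (-(2 * c)) * Real.exp z + (-(2 * c)) * (z * Real.exp z) + 1
        + 2 * z + z ^ 2 := fun z => by
    have : Real.exp (z - v / 2) = c * Real.exp z := by rw [hc, ← Real.exp_add]; ring_nf
    rw [this, show Real.exp (2 * z) = Real.exp z ^ 2 by rw [← Real.exp_nat_mul]; norm_num]
    ring
  have i1 := (integrable_exp_mul_gaussianReal (μ := 0) (v := v) 2).const_mul (c ^ 2)
  have i2 := (he.integrable (by norm_num)).const_mul (-(2 * c))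
  have i3 : Integrable (fun z => (-(2 * c)) * (z * Real.exp z)) (gaussianReal 0 v) :=
    (hz2.integrable_mul he).const_mul _
  have i4 := integrable_const (μ := gaussianReal 0 v) (1 : ℝ)
  have i5 : Integrable (fun z : ℝ => 2 * z) (gaussianReal 0 v) :=
    (hz2.integrable (by norm_num)).const_mul 2
  have i6 : Integrable (fun z : ℝ => z ^ 2) (gaussianReal 0 v) := hz2.integrable_sq
  simp only [e]
  rw [integral_add ((((i1.fun_add i2).fun_add i3).fun_add i4).fun_add i5) i6,
    integral_add (((i1.fun_add i2).fun_add i3).fun_add i4) i5, integral_add ((i1.fun_add i2).fun_add i3) i4,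
    integral_add (i1.fun_add i2) i3, integral_add i1 i2]
  have h6 : ∫ z : ℝ, 2 * z ∂gaussianReal 0 v = 0 := by rw [integral_const_mul, h5, mul_zero]
  simp only [integral_const_mul, h1, h2, h3, h4, h6]
  have c1 : c * Real.exp (v * 1 ^ 2 / 2) = 1 := by rw [hc, ← Real.exp_add]; ring_nf; simp
  have c2 : c * Real.exp (v / 2) = 1 := by rw [hc, ← Real.exp_add]; ring_nf; simp
  have c3 : c ^ 2 * Real.exp (v * 2 ^ 2 / 2) = Real.exp v := by
    rw [hc, ← Real.exp_nat_mul, ← Real.exp_add]; push_cast; ring_nf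
  simp only [integral_const, probReal_univ, smul_eq_mul]
  linear_combination c3 - 2 * c1 - 2 * v * c2

end GaussianMoments

/-! ### Scalar Brownian motion and its exponential martingale -/

section ScalarBrownianMotion

/-- A real Brownian motion on `[0,1]` with variance `c` per unit of time. -/
structure IsScalarBrownianMotion {Ω : Type*} {mΩ : MeasurableSpace Ω}
    (P : Measure Ω) (𝓕 : Filtration I mΩ) (c : NNReal) (W : I → Ω → ℝ) : Prop where
  adapted : ∀ t, Measurable[𝓕 t] (W t)
  zero : ∀ᵐ ω ∂P, W 0 ω = 0
  cont : ∀ᵐ ω ∂P, Continuous fun t => W t ω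
  indep : ∀ s t, s ≤ t →
    Indep (MeasurableSpace.comap (fun ω => W t ω - W s ω) inferInstance) (𝓕 s) P
  law : ∀ s t, s ≤ t →
    HasLaw (fun ω => W t ω - W s ω) (gaussianReal 0 (c * Real.toNNReal ((t : ℝ) - (s : ℝ)))) P

/-- The exponential martingale of a Brownian motion of variance `c`. -/
noncomputable def expMartingale {Ω : Type*} (c : NNReal) (W : I → Ω → ℝ) (t : I) (ω : Ω) : ℝ :=
  Real.exp (W t ω - c * t / 2)

variable {Ω : Type*} {mΩ : MeasurableSpace Ω} {P : Measure Ω} {𝓕 : Filtration I mΩ}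
  {c : NNReal} {W : I → Ω → ℝ}

namespace IsScalarBrownianMotion

theorem measurable_sub (hW : IsScalarBrownianMotion P 𝓕 c W) {s t : I} (h : s ≤ t) :
    Measurable[𝓕 t] fun ω => W t ω - W s ω :=
  Measurable.fun_sub (hW.adapted t) ((hW.adapted s).mono (𝓕.mono h) le_rfl)

theorem memLp_comp_sub (hW : IsScalarBrownianMotion P 𝓕 c W) {s t : I} (h : s ≤ t) {f : ℝ → ℝ}
    (hf : Measurable f)
    (hL : MemLp f 2 (gaussianReal 0 (c * Real.toNNReal ((t : ℝ) - (s : ℝ))))) :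
    MemLp (fun ω => f (W t ω - W s ω)) 2 P := by
  rw [← (hW.law s t h).map_eq] at hL
  exact (memLp_map_measure_iff hf.aestronglyMeasurable (hW.law s t h).aemeasurable).1 hL

theorem integral_comp_sub (hW : IsScalarBrownianMotion P 𝓕 c W) {s t : I} (h : s ≤ t) {f : ℝ → ℝ}
    (hf : Measurable f) :
    ∫ ω, f (W t ω - W s ω) ∂P =
      ∫ z, f z ∂gaussianReal 0 (c * Real.toNNReal ((t : ℝ) - (s : ℝ))) := by
  rw [← (hW.law s t h).map_eq, integral_map (hW.law s t h).aemeasurable hf.aestronglyMeasurable]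

theorem indep_comp (hW : IsScalarBrownianMotion P 𝓕 c W) {s t : I} (h : s ≤ t) {f : ℝ → ℝ}
    (hf : Measurable f) :
    Indep (MeasurableSpace.comap (fun ω => f (W t ω - W s ω)) inferInstance) (𝓕 s) P :=
  indep_of_indep_of_le_left (hW.indep s t h)
    ((hf.comp (comap_measurable fun ω => W t ω - W s ω)).comap_le)

theorem memLp_expMartingale (hW : IsScalarBrownianMotion P 𝓕 c W) (t : I) :
    MemLp (expMartingale c W t) 2 P := by
  have h := (hW.memLp_comp_sub (zero_le (a := t)) Real.measurable_exp
    (memLp_exp_gaussianReal_zero _)).const_mul (Real.exp (-(c * t / 2)))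
  refine h.ae_eq ?_
  filter_upwards [hW.zero] with ω hω
  rw [hω, ← Real.exp_add, expMartingale]
  ring_nf

theorem integral_sq_expMartingale (hW : IsScalarBrownianMotion P 𝓕 c W) (t : I) :
    ∫ ω, expMartingale c W t ω ^ 2 ∂P = Real.exp (c * t) := by
  have h := hW.integral_comp_sub (zero_le (a := t)) (f := fun z => Real.exp (2 * z)) (by fun_prop)
  rw [integral_exp_mul_gaussianReal_zero] at h
  have e : ∫ ω, expMartingale c W t ω ^ 2 ∂P =
      ∫ ω, Real.exp (-(c * t)) * Real.exp (2 * (W t ω - W 0 ω)) ∂P := by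
    refine integral_congr_ae ?_
    filter_upwards [hW.zero] with ω hω
    rw [hω, ← Real.exp_add, expMartingale, ← Real.exp_nat_mul]
    push_cast; ring_nf
  have ht : (0 : ℝ) ≤ t := t.2.1
  rw [e, integral_const_mul, h, ← Real.exp_add]
  simp only [NNReal.coe_mul, Set.Icc.coe_zero, sub_zero, Real.coe_toNNReal _ ht]
  ring_nf

/-- The left-endpoint Riemann sums of the exponential martingale against the Brownian motion
approximate its increment in mean square. -/
theorem integral_sq_expMartingale_error_le [IsProbabilityMeasure P]
    (hW : IsScalarBrownianMotion P 𝓕 c W) (π : ℕ → I) (hπ : Monotone π) (δ : ℝ)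
    (hδ : ∀ j, (π (j + 1) : ℝ) - π j ≤ δ) (hcδ : c * δ ≤ 1) (N : ℕ) :
    MemLp (fun ω => expMartingale c W (π N) ω - expMartingale c W (π 0) ω -
      ∑ j ∈ Finset.range N, expMartingale c W (π j) ω * (W (π (j + 1)) ω - W (π j) ω)) 2 P ∧
    ∫ ω, (expMartingale c W (π N) ω - expMartingale c W (π 0) ω -
      ∑ j ∈ Finset.range N, expMartingale c W (π j) ω * (W (π (j + 1)) ω - W (π j) ω)) ^ 2 ∂P
      ≤ Real.exp c * (c ^ 2 * δ) := by
  set v : ℕ → NNReal := fun j => c * Real.toNNReal ((π (j + 1) : ℝ) - π j) with hv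
  have hΔ : ∀ j, (0 : ℝ) ≤ (π (j + 1) : ℝ) - π j := fun j =>
    sub_nonneg.2 (hπ j.le_succ)
  have hvr : ∀ j, (v j : ℝ) = c * ((π (j + 1) : ℝ) - π j) := fun j => by
    simp [hv, Real.coe_toNNReal _ (hΔ j)]
  set f : ℕ → ℝ → ℝ := fun j z => Real.exp (z - v j / 2) - 1 - z with hf
  have hfm : ∀ j, Measurable (f j) := fun j => by simp only [hf]; fun_prop
  have hsum : ∀ ω, expMartingale c W (π N) ω - expMartingale c W (π 0) ω -
      ∑ j ∈ Finset.range N, expMartingale c W (π j) ω * (W (π (j + 1)) ω - W (π j) ω) =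
      ∑ j ∈ Finset.range N, expMartingale c W (π j) ω * f j (W (π (j + 1)) ω - W (π j) ω) := by
    intro ω
    rw [← Finset.sum_range_sub (fun j => expMartingale c W (π j) ω), ← Finset.sum_sub_distrib]
    refine Finset.sum_congr rfl fun j _ => ?_
    -- The multiplicative increment makes each error an adapted factor times a centred function of
    -- an independent increment, which is the form the isometry needs.
    have : expMartingale c W (π (j + 1)) ω = expMartingale c W (π j) ω *
        Real.exp (W (π (j + 1)) ω - W (π j) ω - v j / 2) := by
      rw [expMartingale, expMartingale, ← Real.exp_add, hvr]; ring_nf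
    rw [this]; simp only [hf]; ring
  have key := memLp_and_integral_sq_sum_mul (P := P) (fun j => 𝓕 (π j)) (fun j => 𝓕.le _)
    (fun i j hij => 𝓕.mono (hπ hij)) (fun j => expMartingale c W (π j))
    (fun j ω => f j (W (π (j + 1)) ω - W (π j) ω))
    (fun j => Real.measurable_exp.comp ((hW.adapted (π j)).sub_const _))
    (fun j => (hfm j).comp (hW.measurable_sub (hπ j.le_succ)))
    (fun j => hW.indep_comp (hπ j.le_succ) (hfm j))
    (fun j => hW.memLp_expMartingale _)
    (fun j => hW.memLp_comp_sub (hπ j.le_succ) (hfm j) (memLp_exp_error_gaussianReal _))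
    (fun j => by
      rw [hW.integral_comp_sub (hπ j.le_succ) (hfm j)]
      exact integral_exp_error_gaussianReal _) N
  simp only [hsum]
  refine ⟨key.2.1, key.2.2.trans_le ?_⟩
  have hterm : ∀ j ∈ Finset.range N, (∫ ω, expMartingale c W (π j) ω ^ 2 ∂P) *
      ∫ ω, f j (W (π (j + 1)) ω - W (π j) ω) ^ 2 ∂P ≤
      Real.exp c * (c ^ 2 * δ) * ((π (j + 1) : ℝ) - π j) := by
    intro j _
    rw [hW.integral_sq_expMartingale, hW.integral_comp_sub (hπ j.le_succ)
      (f := fun z => f j z ^ 2) ((hfm j).pow_const 2), integral_sq_exp_error_gaussianReal,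
      mul_assoc]
    have hv0 : (0 : ℝ) ≤ v j := (v j).2
    have hv1 : (v j : ℝ) ≤ 1 := by
      rw [hvr]; exact (mul_le_mul_of_nonneg_left (hδ j) c.2).trans hcδ
    -- The bound `exp v - 1 - v ≤ v ^ 2` is available for `|v| ≤ 1`; this is the role of `hcδ`.
    have h1 := (abs_le.1 (Real.abs_exp_sub_one_sub_id_le (x := (v j : ℝ))
      (by rwa [abs_of_nonneg hv0]))).2
    refine mul_le_mul ?_ ?_ ?_ (Real.exp_nonneg _)
    · refine Real.exp_le_exp.2 ?_
      exact mul_le_of_le_one_right c.2 (π j).2.2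
    · refine h1.trans ?_
      rw [hvr, mul_pow, sq ((π (j + 1) : ℝ) - π j), mul_assoc]
      exact mul_le_mul_of_nonneg_left (mul_le_mul_of_nonneg_right (hδ j) (hΔ j)) (sq_nonneg _)
    · linarith [Real.add_one_le_exp (v j : ℝ)]
  refine (Finset.sum_le_sum hterm).trans ?_
  rw [← Finset.mul_sum, Finset.sum_range_sub (fun j => ((π j : I) : ℝ))]
  refine mul_le_of_le_one_right ?_ ?_
  · have := (hΔ 0).trans (hδ 0)
    positivity
  · linarith [(π N).2.2, (π 0).2.1]

end IsScalarBrownianMotion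

end ScalarBrownianMotion

/-! ### Dyadic partitions and left Riemann sums -/

section Dyadic

/-- The time `k / 2 ^ n`, capped at `1`. -/
noncomputable def dyadicTime (n k : ℕ) : I :=
  ⟨min ((k : ℝ) / 2 ^ n) 1, le_min (by positivity) zero_le_one, min_le_right _ _⟩

theorem dyadicTime_mono (n : ℕ) : Monotone (dyadicTime n) := by
  intro j k h
  change min ((j : ℝ) / 2 ^ n) 1 ≤ min ((k : ℝ) / 2 ^ n) 1
  have : (j : ℝ) ≤ k := by exact_mod_cast h
  gcongr

theorem dyadicTime_zero (n : ℕ) : dyadicTime n 0 = 0 := by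
  ext; simp [dyadicTime]

theorem dyadicTime_two_pow (n : ℕ) : dyadicTime n (2 ^ n) = 1 := by
  ext; simp [dyadicTime]

/-- The dyadic partition of `[0, s]`. -/
noncomputable def dyadicPartition (s : I) (n j : ℕ) : I := min (dyadicTime n j) s

theorem dyadicPartition_mono (s : I) (n : ℕ) : Monotone (dyadicPartition s n) :=
  fun _ _ h => min_le_min_right _ (dyadicTime_mono n h)

theorem dyadicPartition_zero (s : I) (n : ℕ) : dyadicPartition s n 0 = 0 := by
  rw [dyadicPartition, dyadicTime_zero, min_eq_left (zero_le (a := s))]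

theorem dyadicPartition_two_pow (s : I) (n : ℕ) : dyadicPartition s n (2 ^ n) = s := by
  rw [dyadicPartition, dyadicTime_two_pow]; exact min_eq_right s.2.2

theorem dyadicPartition_le (s : I) (n j : ℕ) : dyadicPartition s n j ≤ s := min_le_right _ _

theorem dyadicPartition_succ_sub_le (s : I) (n j : ℕ) :
    (dyadicPartition s n (j + 1) : ℝ) - dyadicPartition s n j ≤ (1 / 2 : ℝ) ^ n := by
  have hc : ∀ k, (dyadicPartition s n k : ℝ) = min (min ((k : ℝ) / 2 ^ n) 1) s := fun k =>
    (Subtype.mono_coe (fun r : ℝ => r ∈ I)).map_min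
  have h0 : (0 : ℝ) ≤ (1 / 2 : ℝ) ^ n := by positivity
  have h1 : ((j + 1 : ℕ) : ℝ) / 2 ^ n = (j : ℝ) / 2 ^ n + (1 / 2 : ℝ) ^ n := by
    push_cast; rw [add_div, one_div_pow]
  rw [hc, hc, h1, sub_le_iff_le_add, add_comm ((1 / 2 : ℝ) ^ n), ← min_add_add_right,
    ← min_add_add_right]
  refine min_le_min (min_le_min le_rfl ?_) ?_ <;> linarith

/-- Localisation will be tested on the countable set of dyadic times only, so partitions must not
leave it. -/
theorem range_dyadicPartition_subset {s : I} (hs : s ∈ Set.range (Function.uncurry dyadicTime))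
    (n j : ℕ) : dyadicPartition s n j ∈ Set.range (Function.uncurry dyadicTime) := by
  rcases min_choice (dyadicTime n j) s with h | h
  · rw [dyadicPartition, h]; exact ⟨(n, j), rfl⟩
  · rw [dyadicPartition, h]; exact hs

/-- The left rectangle lies below the graph of the increasing function `(p + 1) * t ^ p`. -/
theorem mul_pow_mul_sub_le_pow_succ_sub (p : ℕ) {a b : ℝ} (ha : 0 ≤ a) (hab : a ≤ b) :
    (p + 1) * (a ^ p * (b - a)) ≤ b ^ (p + 1) - a ^ (p + 1) := by
  induction p with
  | zero => simp
  | succ p ih =>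
    have e : b ^ (p + 1 + 1) - a ^ (p + 1 + 1) =
      b * (b ^ (p + 1) - a ^ (p + 1)) + a ^ (p + 1) * (b - a) := by ring
    have h1 : a * ((p + 1) * (a ^ p * (b - a))) ≤ b * (b ^ (p + 1) - a ^ (p + 1)) :=
      mul_le_mul hab ih (mul_nonneg (by positivity)
        (mul_nonneg (by positivity) (sub_nonneg.2 hab))) (ha.trans hab)
    rw [e]; push_cast
    calc ((p : ℝ) + 1 + 1) * (a ^ (p + 1) * (b - a))
        = a * ((p + 1) * (a ^ p * (b - a))) + a ^ (p + 1) * (b - a) := by ring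
      _ ≤ _ := by linarith

/-- A left Riemann sum of `t ^ p` is bounded by the integral. -/
theorem sum_pow_mul_sub_le (p : ℕ) (π : ℕ → I) (hπ : Monotone π) (N : ℕ) :
    ∑ j ∈ Finset.range N, (π j : ℝ) ^ p * ((π (j + 1) : ℝ) - π j) ≤
      (π N : ℝ) ^ (p + 1) / (p + 1) := by
  rw [le_div_iff₀ (by positivity), mul_comm, Finset.mul_sum]
  calc _ ≤ ∑ j ∈ Finset.range N, ((π (j + 1) : ℝ) ^ (p + 1) - (π j : ℝ) ^ (p + 1)) :=
        Finset.sum_le_sum fun j _ =>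
          mul_pow_mul_sub_le_pow_succ_sub p (π j).2.1 (hπ j.le_succ)
    _ = (π N : ℝ) ^ (p + 1) - (π 0 : ℝ) ^ (p + 1) :=
        Finset.sum_range_sub (fun j => (π j : ℝ) ^ (p + 1)) N
    _ ≤ _ := by
        have : (0 : ℝ) ≤ (π 0 : ℝ) ^ (p + 1) := pow_nonneg (π 0).2.1 _
        linarith

end Dyadic

/-- Fatou's lemma: second-moment bounds pass to almost sure limits, the only convergence at hand for
the Riemann sums of `M`. -/
theorem integral_sq_le_of_tendsto_ae {Ω : Type*} {mΩ : MeasurableSpace Ω} {P : Measure Ω}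
    {f : ℕ → Ω → ℝ} {g : Ω → ℝ} (hf : ∀ n, MemLp (f n) 2 P) (hfm : ∀ n, Measurable (f n))
    (hg : AEStronglyMeasurable g P)
    (h : ∀ᵐ ω ∂P, Tendsto (fun n => f n ω) atTop (nhds (g ω))) (b : ℝ)
    (hb : ∀ n, ∫ ω, f n ω ^ 2 ∂P ≤ b) : ∫ ω, g ω ^ 2 ∂P ≤ b := by
  have hb0 : 0 ≤ b := (integral_nonneg fun ω => sq_nonneg _).trans (hb 0)
  rw [integral_eq_lintegral_of_nonneg_ae (ae_of_all _ fun ω => sq_nonneg _) (hg.pow 2)]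
  refine ENNReal.toReal_le_of_le_ofReal hb0 ?_
  calc ∫⁻ ω, ENNReal.ofReal (g ω ^ 2) ∂P
      = ∫⁻ ω, liminf (fun n => ENNReal.ofReal (f n ω ^ 2)) atTop ∂P := by
        refine lintegral_congr_ae ?_
        filter_upwards [h] with ω hω
        exact ((ENNReal.continuous_ofReal.tendsto _).comp (hω.pow 2)).liminf_eq.symm
    _ ≤ liminf (fun n => ∫⁻ ω, ENNReal.ofReal (f n ω ^ 2) ∂P) atTop :=
        lintegral_liminf_le fun n => by have := hfm n; fun_prop
    _ ≤ ENNReal.ofReal b := by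
        refine liminf_le_of_le (by isBoundedDefault) fun x hx => ?_
        obtain ⟨n, hn⟩ := hx.exists
        refine hn.trans ?_
        rw [← ofReal_integral_eq_lintegral_ofReal (hf n).integrable_sq
          (ae_of_all _ fun ω => sq_nonneg _)]
        exact ENNReal.ofReal_le_ofReal (hb n)

/-! ### Pathwise uniqueness for `dM = M dW` -/

section Uniqueness

variable {Ω : Type*} {mΩ : MeasurableSpace Ω} {P : Measure Ω} {𝓕 : Filtration I mΩ}
  {c : NNReal} {W : I → Ω → ℝ}

namespace IsScalarBrownianMotion

/-- Along a common subsequence of the dyadic partitions, the Riemann sums of the difference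
between a solution of `dM = M dW` and `x` times the exponential martingale converge to that
difference. -/
theorem exists_seq_tendsto_sub_expMartingale [IsProbabilityMeasure P]
    (hW : IsScalarBrownianMotion P 𝓕 c W) {M : I → Ω → ℝ} {x : ℝ} (s : I)
    (hM : TendstoInMeasure P (fun n ω => ∑ j ∈ Finset.range (2 ^ n), M (dyadicPartition s n j) ω *
        (W (dyadicPartition s n (j + 1)) ω - W (dyadicPartition s n j) ω)) atTop
      (fun ω => M s ω - x)) :
    ∃ ns : ℕ → ℕ, ∀ᵐ ω ∂P, Tendsto (fun i => ∑ j ∈ Finset.range (2 ^ ns i),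
      (M (dyadicPartition s (ns i) j) ω - x * expMartingale c W (dyadicPartition s (ns i) j) ω) *
        (W (dyadicPartition s (ns i) (j + 1)) ω - W (dyadicPartition s (ns i) j) ω)) atTop
      (nhds (M s ω - x * expMartingale c W s ω)) := by
  obtain ⟨ns, hns, hMns⟩ := hM.exists_seq_tendsto_ae
  set R : ℕ → Ω → ℝ := fun n ω => expMartingale c W s ω - expMartingale c W 0 ω -
    ∑ j ∈ Finset.range (2 ^ n), expMartingale c W (dyadicPartition s n j) ω *
      (W (dyadicPartition s n (j + 1)) ω - W (dyadicPartition s n j) ω) with hR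
  have hpow : Tendsto (fun n : ℕ => (1 / 2 : ℝ) ^ n) atTop (nhds 0) :=
    tendsto_pow_atTop_nhds_zero_of_lt_one (by norm_num) (by norm_num)
  have hev : ∀ᶠ n : ℕ in atTop, (c : ℝ) * (1 / 2 : ℝ) ^ n ≤ 1 := by
    have : Tendsto (fun n : ℕ => (c : ℝ) * (1 / 2 : ℝ) ^ n) atTop (nhds 0) := by
      simpa using hpow.const_mul (c : ℝ)
    exact this.eventually_le_const zero_lt_one
  obtain ⟨n₀, hn₀⟩ := eventually_atTop.1 hev
  have hbound : ∀ n, n₀ ≤ n → MemLp (R n) 2 P ∧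
      ∫ ω, R n ω ^ 2 ∂P ≤ Real.exp c * (c ^ 2 * (1 / 2 : ℝ) ^ n) := by
    intro n hn
    have := hW.integral_sq_expMartingale_error_le (dyadicPartition s n) (dyadicPartition_mono s n)
      ((1 / 2 : ℝ) ^ n) (dyadicPartition_succ_sub_le s n) (hn₀ n hn) (2 ^ n)
    rw [dyadicPartition_two_pow, dyadicPartition_zero] at this
    exact this
  have hRm : ∀ n, Measurable (R n) := by
    have hE : ∀ t, Measurable (expMartingale c W t) := fun t =>
      Real.measurable_exp.comp ((((hW.adapted t).mono (𝓕.le t) le_rfl)).sub_const _)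
    have hWm : ∀ t, Measurable (W t) := fun t => (hW.adapted t).mono (𝓕.le t) le_rfl
    intro n
    exact ((hE _).fun_sub (hE _)).fun_sub (Finset.measurable_fun_sum _ fun j _ =>
      (hE _).fun_mul ((hWm _).fun_sub (hWm _)))
  have hRt : TendstoInMeasure P (fun i ω => R (ns i) ω ^ 2) atTop (fun _ => (0 : ℝ)) := by
    refine tendstoInMeasure_of_tendsto_eLpNorm (p := 1) one_ne_zero
      (fun i => ((hRm _).pow_const 2).aestronglyMeasurable) aestronglyMeasurable_const ?_
    have hle : ∀ᶠ i in atTop, eLpNorm ((fun ω => R (ns i) ω ^ 2) - fun _ : Ω => (0 : ℝ)) 1 P ≤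
        ENNReal.ofReal (Real.exp c * (c ^ 2 * (1 / 2 : ℝ) ^ (ns i))) := by
      filter_upwards [eventually_ge_atTop n₀] with i hi
      obtain ⟨h1, h2⟩ := hbound (ns i) (hi.trans (hns.id_le i))
      rw [eLpNorm_one_eq_lintegral_enorm]
      have : ∀ ω, ‖((fun ω => R (ns i) ω ^ 2) - fun _ : Ω => (0 : ℝ)) ω‖ₑ =
          ENNReal.ofReal (R (ns i) ω ^ 2) := fun ω => by
        rw [Pi.sub_apply, sub_zero, Real.enorm_eq_ofReal (sq_nonneg _)]
      rw [lintegral_congr this, ← ofReal_integral_eq_lintegral_ofReal h1.integrable_sq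
        (ae_of_all _ fun ω => sq_nonneg _)]
      exact ENNReal.ofReal_le_ofReal h2
    have hlim : Tendsto (fun i => ENNReal.ofReal
        (Real.exp c * (c ^ 2 * (1 / 2 : ℝ) ^ (ns i)))) atTop (nhds 0) := by
      have h2 := ((hpow.comp hns.tendsto_atTop).const_mul ((c : ℝ) ^ 2)).const_mul (Real.exp c)
      rw [mul_zero, mul_zero] at h2
      simpa only [ENNReal.ofReal_zero, Function.comp_def] using
        (ENNReal.continuous_ofReal.tendsto _).comp h2
    exact tendsto_of_tendsto_of_tendsto_of_le_of_le' tendsto_const_nhds hlim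
      (Eventually.of_forall fun _ => zero_le) hle
  -- A second extraction, along the first subsequence, makes both Riemann sums converge almost
  -- surely together.
  obtain ⟨ms, hms, hRms⟩ := hRt.exists_seq_tendsto_ae
  refine ⟨fun i => ns (ms i), ?_⟩
  filter_upwards [hMns, hRms, hW.zero] with ω h1 h2 h0
  have hR0 : Tendsto (fun i => R (ns (ms i)) ω) atTop (nhds 0) := by
    rw [tendsto_zero_iff_abs_tendsto_zero]
    have := (Real.continuous_sqrt.tendsto _).comp h2
    simpa [Function.comp_def, Real.sqrt_sq_eq_abs] using this
  have h3 := (h1.comp hms.tendsto_atTop).sub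
    (((tendsto_const_nhds (x := expMartingale c W s ω - 1)).sub hR0).const_mul x)
  have hE0 : expMartingale c W 0 ω = 1 := by simp [expMartingale, h0]
  refine (h3.congr fun i => ?_).trans (le_of_eq ?_)
  · simp only [hR, hE0, Function.comp_apply, sub_mul, Finset.sum_sub_distrib, mul_assoc,
      ← Finset.mul_sum]
    ring
  · congr 1; ring

/-- **Pathwise uniqueness** for `dM = M dW`, with the Itô integral read as a limit in probability
of left-endpoint Riemann sums. -/
theorem eq_mul_expMartingale_of_bounded [IsProbabilityMeasure P]
    (hW : IsScalarBrownianMotion P 𝓕 c W) {M : I → Ω → ℝ} {x : ℝ}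
    (hMm : ∀ t, Measurable[𝓕 t] (M t))
    (hM : ∀ s, TendstoInMeasure P (fun n ω => ∑ j ∈ Finset.range (2 ^ n),
        M (dyadicPartition s n j) ω *
        (W (dyadicPartition s n (j + 1)) ω - W (dyadicPartition s n j) ω)) atTop
      (fun ω => M s ω - x)) (K : ℝ) (hK : 0 ≤ K) {s : I}
    (hs : s ∈ Set.range (Function.uncurry dyadicTime)) :
    ∀ᵐ ω ∂P, (∀ q ∈ Set.range (Function.uncurry dyadicTime), q ≤ s →
      |M q ω - x * expMartingale c W q ω| ≤ K) → M s ω = x * expMartingale c W s ω := by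
  set S : Set I := Set.range (Function.uncurry dyadicTime) with hS
  have hSc : S.Countable := Set.countable_range _
  set D : I → Ω → ℝ := fun t ω => M t ω - x * expMartingale c W t ω with hD
  have hDm : ∀ t, Measurable[𝓕 t] (D t) := fun t => (hMm t).fun_sub
    ((Real.measurable_exp.comp ((hW.adapted t).sub_const _)).const_mul x)
  -- Adapted substitute for a stopping time. It is a countable intersection, hence in `𝓕 t`, and it
  -- decreases in `t`.
  set G : I → Set Ω := fun t => {ω | ∀ q ∈ S, q ≤ t → |D q ω| ≤ K} with hG
  have hGm : ∀ t, MeasurableSet[𝓕 t] (G t) := by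
    intro t
    have : G t = ⋂ q ∈ S ∩ Set.Iic t, {ω | |D q ω| ≤ K} := by
      ext ω; simp [hG]
    rw [this]
    refine MeasurableSet.biInter (hSc.mono Set.inter_subset_left) fun q hq => ?_
    exact (continuous_abs.measurable.comp ((hDm q).mono (𝓕.mono hq.2) le_rfl)) measurableSet_Iic
  set T : I → Ω → ℝ := fun t => (G t).indicator (D t) with hT
  have hTm : ∀ t, Measurable[𝓕 t] (T t) := fun t => (hDm t).indicator (hGm t)
  have hTb : ∀ t ∈ S, ∀ ω, |T t ω| ≤ K := by
    intro t ht ω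
    by_cases h : ω ∈ G t
    · simp only [hT, Set.indicator_of_mem h]; exact h t ht le_rfl
    · simpa only [hT, Set.indicator_of_notMem h, abs_zero] using hK
  have hT2 : ∀ t ∈ S, MemLp (T t) 2 P := fun t ht =>
    MemLp.of_bound ((hTm t).mono (𝓕.le t) le_rfl).aestronglyMeasurable K
      (ae_of_all _ fun ω => hTb t ht ω)
  -- The isometry gives in effect `E T_t² ≤ c ∫₀ᵗ E T_s² ds`. Iterating from the trivial bound `K ^
  -- 2` gains a factorial each time.
  have claim : ∀ p : ℕ, ∀ t ∈ S, ∫ ω, T t ω ^ 2 ∂P ≤ K ^ 2 * ((c * t) ^ p / p.factorial) := by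
    intro p
    induction p with
    | zero =>
      intro t ht
      calc ∫ ω, T t ω ^ 2 ∂P ≤ ∫ _, K ^ 2 ∂P :=
            integral_mono (hT2 t ht).integrable_sq (integrable_const _)
              fun ω => sq_le_sq' (abs_le.1 (hTb t ht ω)).1 (abs_le.1 (hTb t ht ω)).2
        _ = _ := by simp
    | succ p ih =>
      intro t ht
      have hπS : ∀ n j, dyadicPartition t n j ∈ S := range_dyadicPartition_subset ht
      have key := fun n => memLp_and_integral_sq_sum_mul (P := P)
        (fun j => 𝓕 (dyadicPartition t n j)) (fun j => 𝓕.le _)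
        (fun i j hij => 𝓕.mono (dyadicPartition_mono t n hij))
        (fun j => T (dyadicPartition t n j))
        (fun j ω => W (dyadicPartition t n (j + 1)) ω - W (dyadicPartition t n j) ω)
        (fun j => hTm _) (fun j => hW.measurable_sub (dyadicPartition_mono t n j.le_succ))
        (fun j => hW.indep _ _ (dyadicPartition_mono t n j.le_succ))
        (fun j => hT2 _ (hπS n j))
        (fun j => hW.memLp_comp_sub (dyadicPartition_mono t n j.le_succ) measurable_id
          (memLp_id_gaussianReal 2))
        (fun j => (hW.integral_comp_sub (dyadicPartition_mono t n j.le_succ)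
          measurable_id).trans integral_id_gaussianReal) (2 ^ n)
      obtain ⟨ns, hns⟩ := hW.exists_seq_tendsto_sub_expMartingale t (hM t)
      have hGt : MeasurableSet (G t) := 𝓕.le t _ (hGm t)
      set Z : ℕ → Ω → ℝ := fun n ω => ∑ j ∈ Finset.range (2 ^ n), T (dyadicPartition t n j) ω *
        (W (dyadicPartition t n (j + 1)) ω - W (dyadicPartition t n j) ω) with hZ
      have hZm : ∀ n, Measurable (Z n) := fun n => (key n).1.mono (𝓕.le _) le_rfl
      have hZb : ∀ n, ∫ ω, Z n ω ^ 2 ∂P ≤ K ^ 2 * ((c * t) ^ (p + 1) / (p + 1).factorial) := by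
        intro n
        refine (key n).2.2.trans_le ?_
        have hterm : ∀ j ∈ Finset.range (2 ^ n), (∫ ω, T (dyadicPartition t n j) ω ^ 2 ∂P) *
            ∫ ω, (W (dyadicPartition t n (j + 1)) ω - W (dyadicPartition t n j) ω) ^ 2 ∂P ≤
            K ^ 2 * c ^ (p + 1) / p.factorial * ((dyadicPartition t n j : ℝ) ^ p *
              ((dyadicPartition t n (j + 1) : ℝ) - dyadicPartition t n j)) := by
          intro j _
          have hΔ : (0 : ℝ) ≤ (dyadicPartition t n (j + 1) : ℝ) - dyadicPartition t n j :=
            sub_nonneg.2 (dyadicPartition_mono t n j.le_succ)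
          rw [hW.integral_comp_sub (dyadicPartition_mono t n j.le_succ) (f := fun z => z ^ 2)
            (by fun_prop), integral_sq_gaussianReal_zero, NNReal.coe_mul, Real.coe_toNNReal _ hΔ]
          refine (mul_le_mul_of_nonneg_right (ih _ (hπS n j)) (mul_nonneg c.coe_nonneg hΔ)).trans_eq ?_
          rw [mul_pow, pow_succ (c : ℝ) p]; ring
        refine (Finset.sum_le_sum hterm).trans ?_
        rw [← Finset.mul_sum]
        have := sum_pow_mul_sub_le p _ (dyadicPartition_mono t n) (2 ^ n)
        rw [dyadicPartition_two_pow] at this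
        refine (mul_le_mul_of_nonneg_left this (by positivity)).trans_eq ?_
        rw [Nat.factorial_succ, mul_pow]; push_cast
        field_simp
      refine integral_sq_le_of_tendsto_ae (f := fun i => (G t).indicator (Z (ns i)))
        (fun i => (key _).2.1.indicator hGt) (fun i => (hZm _).indicator hGt)
        (hT2 t ht).1 ?_ _ fun i => ?_
      · filter_upwards [hns] with ω hω
        by_cases h : ω ∈ G t
        · rw [show T t ω = D t ω from Set.indicator_of_mem h _]
          simp only [Set.indicator_of_mem h]
          refine hω.congr fun i => Finset.sum_congr rfl fun j _ => ?_
          -- Since `G` decreases, on `G t` the truncated and untruncated Riemann sums coincide.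
          have hj : ω ∈ G (dyadicPartition t (ns i) j) := fun q hq hqt =>
            h q hq (hqt.trans (dyadicPartition_le _ _ _))
          rw [show T (dyadicPartition t (ns i) j) ω = D (dyadicPartition t (ns i) j) ω from
            Set.indicator_of_mem hj _]
        · rw [show T t ω = 0 from Set.indicator_of_notMem h _]
          simp only [Set.indicator_of_notMem h]; exact tendsto_const_nhds
      · refine (integral_mono_ae ((key _).2.1.indicator hGt).integrable_sq
          (key _).2.1.integrable_sq (ae_of_all _ fun ω => ?_)).trans (hZb (ns i))
        by_cases h : ω ∈ G t
        · simp only [Set.indicator_of_mem h]; exact le_rfl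
        · simp only [Set.indicator_of_notMem h, zero_pow two_ne_zero]; exact sq_nonneg _
  have hzero : ∫ ω, T s ω ^ 2 ∂P = 0 := by
    refine le_antisymm ?_ (integral_nonneg fun ω => sq_nonneg _)
    have hlim := (FloorSemiring.tendsto_pow_div_factorial_atTop ((c : ℝ) * s)).const_mul (K ^ 2)
    rw [mul_zero] at hlim
    exact ge_of_tendsto' hlim fun p => claim p s hs
  rw [integral_eq_zero_iff_of_nonneg (fun ω => sq_nonneg _) (hT2 s hs).integrable_sq] at hzero
  filter_upwards [hzero] with ω hω hωG
  have hmem : ω ∈ G s := hωG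
  have : T s ω = 0 := by simpa using hω
  simp only [hT, Set.indicator_of_mem hmem, hD] at this
  linarith

/-- Almost every path of the difference is continuous on a compact interval, hence bounded by some
natural `K`, and the countably many exceptional null sets can be merged. -/
theorem eq_mul_expMartingale [IsProbabilityMeasure P]
    (hW : IsScalarBrownianMotion P 𝓕 c W) {M : I → Ω → ℝ} {x : ℝ}
    (hMm : ∀ t, Measurable[𝓕 t] (M t)) (hMc : ∀ᵐ ω ∂P, Continuous fun t => M t ω)
    (hM : ∀ s, TendstoInMeasure P (fun n ω => ∑ j ∈ Finset.range (2 ^ n),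
        M (dyadicPartition s n j) ω *
        (W (dyadicPartition s n (j + 1)) ω - W (dyadicPartition s n j) ω)) atTop
      (fun ω => M s ω - x)) {s : I}
    (hs : s ∈ Set.range (Function.uncurry dyadicTime)) :
    ∀ᵐ ω ∂P, M s ω = x * expMartingale c W s ω := by
  have h : ∀ᵐ ω ∂P, ∀ K : ℕ, (∀ q ∈ Set.range (Function.uncurry dyadicTime), q ≤ s →
      |M q ω - x * expMartingale c W q ω| ≤ K) → M s ω = x * expMartingale c W s ω :=
    ae_all_iff.2 fun K => hW.eq_mul_expMartingale_of_bounded hMm hM K K.cast_nonneg hs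
  filter_upwards [h, hMc, hW.cont] with ω hω hMω hWω
  have hcont : Continuous fun t => M t ω - x * expMartingale c W t ω := by
    unfold expMartingale; fun_prop
  obtain ⟨C, hC⟩ := isCompact_univ.exists_bound_of_continuousOn hcont.continuousOn
  obtain ⟨K, hK⟩ := exists_nat_ge C
  exact hω K fun q _ _ => (hC q (Set.mem_univ q)).trans hK

end IsScalarBrownianMotion

end Uniqueness

/-! ### Linear forms of Gaussian vectors; convergence in measure by coordinates -/

section LinearForms

/-- A linear form of independent centred Gaussians with common variance is Gaussian. -/
theorem map_sum_mul_pi_gaussianReal {ι : Type*} [Fintype ι] (a : ι → ℝ) (v : NNReal) :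
    (Measure.pi fun _ : ι => gaussianReal 0 v).map (fun z => ∑ j, a j * z j) =
      gaussianReal 0 (Real.toNNReal (∑ j, a j ^ 2) * v) := by
  have hm : Measurable fun z : ι → ℝ => ∑ j, a j * z j := by fun_prop
  have : IsProbabilityMeasure
      ((Measure.pi fun _ : ι => gaussianReal 0 v).map (fun z => ∑ j, a j * z j)) :=
    Measure.isProbabilityMeasure_map hm.aemeasurable
  refine Measure.ext_of_charFun ?_
  ext t
  rw [charFun_apply_real, integral_map hm.aemeasurable (by fun_prop), charFun_gaussianReal]
  have e : ∀ z : ι → ℝ, Complex.exp (t * ((∑ j, a j * z j : ℝ) : ℂ) * Complex.I) =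
      ∏ j, Complex.exp (((t * a j : ℝ) : ℂ) * (z j : ℂ) * Complex.I) := by
    intro z
    rw [← Complex.exp_sum, ← Finset.sum_mul]
    push_cast
    rw [Finset.mul_sum]
    simp only [mul_assoc]
  simp only [e]
  rw [integral_fintype_prod_eq_prod (𝕜 := ℂ)
    (f := fun j (y : ℝ) => Complex.exp (((t * a j : ℝ) : ℂ) * (y : ℂ) * Complex.I))]
  simp only [← charFun_apply_real, charFun_gaussianReal]
  rw [← Complex.exp_sum]
  have h0 : 0 ≤ ∑ j, a j ^ 2 := Finset.sum_nonneg fun j _ => sq_nonneg _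
  congr 1
  have hc : (((Real.toNNReal (∑ j, a j ^ 2) * v : NNReal) : ℝ) : ℂ) =
      (∑ j, (a j : ℂ) ^ 2) * ((v : ℝ) : ℂ) := by
    rw [NNReal.coe_mul, Real.coe_toNNReal _ h0]; push_cast; rfl
  rw [hc]
  simp only [Complex.ofReal_zero, mul_zero, zero_mul, zero_sub, Finset.sum_neg_distrib,
    Finset.sum_mul, Finset.sum_div]
  congr 1
  refine Finset.sum_congr rfl fun j _ => ?_
  push_cast; ring

end LinearForms

theorem MeasureTheory.TendstoInMeasure.apply_pi {Ω ι : Type*} [Fintype ι] {mΩ : MeasurableSpace Ω}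
    {P : Measure Ω} {f : ℕ → Ω → ι → ℝ} {g : Ω → ι → ℝ} (h : TendstoInMeasure P f atTop g) (i : ι) :
    TendstoInMeasure P (fun n ω => f n ω i) atTop (fun ω => g ω i) := by
  intro ε hε
  refine tendsto_of_tendsto_of_tendsto_of_le_of_le tendsto_const_nhds (h ε hε)
    (fun _ => zero_le) fun n => measure_mono fun ω hω => ?_
  exact le_trans hω (edist_le_pi_edist (f n ω) (g ω) i)

/-! ### Law of the Black–Scholes model on dyadic grids -/

section Model

variable {l : ℕ} {Ω : Type*} {mΩ : MeasurableSpace Ω} {P : Measure Ω} {𝓕 : Filtration I mΩ}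
  {B : I → Ω → Fin l → ℝ} {Γ : Matrix (Fin l) (Fin l) ℝ} {x : Fin l → ℝ} {M : Ω → PathSpace l}

/-- This decouples the system: coordinate `i` of the price is driven by `(ΓB)_i` alone, and
correlation between coordinates plays no role in uniqueness. -/
theorem IsBrownianMotion.isScalarBrownianMotion_mulVec (hB : IsBrownianMotion P 𝓕 B)
    (Γ : Matrix (Fin l) (Fin l) ℝ) (i : Fin l) :
    IsScalarBrownianMotion P 𝓕 (Real.toNNReal (∑ j, Γ i j ^ 2))
      (fun t ω => Γ.mulVec (B t ω) i) := by
  have hφ : Measurable fun z : Fin l → ℝ => Γ.mulVec z i := by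
    unfold Matrix.mulVec dotProduct; fun_prop
  have hsub : ∀ s t, (fun ω => Γ.mulVec (B t ω) i - Γ.mulVec (B s ω) i) =
      fun ω => Γ.mulVec (B t ω - B s ω) i := fun s t => by
    ext ω; rw [Matrix.mulVec_sub, Pi.sub_apply]
  refine ⟨fun t => hφ.comp (hB.adapted t), ?_, ?_, fun s t hst => ?_, fun s t hst => ?_⟩
  · filter_upwards [hB.zero] with ω hω
    rw [hω, Matrix.mulVec_zero, Pi.zero_apply]
  · filter_upwards [hB.cont] with ω hω
    unfold Matrix.mulVec dotProduct
    fun_prop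
  · rw [hsub]
    exact indep_of_indep_of_le_left (hB.indep s t hst)
      (hφ.comp (comap_measurable fun ω => B t ω - B s ω)).comap_le
  · rw [hsub]
    have h := hB.law s t hst
    refine ⟨hφ.comp_aemeasurable h.aemeasurable, ?_⟩
    have e := AEMeasurable.map_map_of_aemeasurable hφ.aemeasurable h.aemeasurable
    rw [h.map_eq] at e
    exact e.symm.trans (map_sum_mul_pi_gaussianReal _ _)

theorem gridPoint_two_pow (n : ℕ) (k : Fin (2 ^ n + 1)) :
    gridPoint (2 ^ n) k = dyadicTime n k := by
  ext
  have h : (k : ℝ) / 2 ^ n ≤ 1 := by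
    rw [div_le_one (by positivity)]
    exact_mod_cast Nat.lt_succ_iff.1 k.isLt
  simp [gridPoint, dyadicTime, min_eq_left h]

theorem IsBlackScholesModel.measurable (hM : IsBlackScholesModel P 𝓕 B Γ x M) : Measurable M := by
  refine measurable_iff_comap_le.2 ?_
  rw [PathSpace.instMeasurableSpace, MeasurableSpace.comap_iSup]
  refine iSup_le fun t => ?_
  rw [MeasurableSpace.comap_comp]
  exact ((hM.adapted t).mono (𝓕.le t) le_rfl).comap_le

/-- At dyadic times a martingale Black–Scholes model is the explicit geometric Brownian motion. -/
theorem IsBlackScholesModel.ae_eq_exp [IsProbabilityMeasure P]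
    (hM : IsBlackScholesModel P 𝓕 B Γ x M) (n k : ℕ) (i : Fin l) :
    ∀ᵐ ω ∂P, M ω (dyadicTime n k) i = x i * Real.exp (Γ.mulVec (B (dyadicTime n k) ω) i -
      (∑ j, Γ i j ^ 2) * dyadicTime n k / 2) := by
  have hW := hM.brownian.isScalarBrownianMotion_mulVec Γ i
  have h := hW.eq_mul_expMartingale (M := fun t ω => M ω t i) (x := x i)
    (fun t => (measurable_pi_apply i).comp (hM.adapted t))
    (ae_of_all _ fun ω => (continuous_apply i).comp (M ω).continuous) (fun s => ?_)
    (s := dyadicTime n k) ⟨(n, k), rfl⟩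
  · have h0 : 0 ≤ ∑ j, Γ i j ^ 2 := Finset.sum_nonneg fun j _ => sq_nonneg _
    simpa only [expMartingale, Real.coe_toNNReal _ h0] using h
  · have h1 := (hM.sde s (fun n => 2 ^ n) (dyadicPartition s) (dyadicPartition_mono s)
      (dyadicPartition_zero s) (dyadicPartition_two_pow s) (fun ε hε => ?_)).apply_pi i
    · refine h1.congr_left fun n => ae_of_all _ fun ω => ?_
      rw [Finset.sum_apply]
      refine Finset.sum_congr rfl fun j _ => ?_
      rw [← Matrix.mulVec_mulVec, Matrix.mulVec_diagonal, Matrix.mulVec_sub, Pi.sub_apply]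
    · have : Tendsto (fun n : ℕ => (1 / 2 : ℝ) ^ n) atTop (nhds 0) :=
        tendsto_pow_atTop_nhds_zero_of_lt_one (by norm_num) (by norm_num)
      filter_upwards [this.eventually_lt_const hε] with n hn j _
      exact (dyadicPartition_succ_sub_le s n j).trans_lt hn

/-- The joint law of consecutive increments of a Brownian motion. -/
theorem IsBrownianMotion.map_increments [IsProbabilityMeasure P] (hB : IsBrownianMotion P 𝓕 B)
    (t : ℕ → I) (ht : Monotone t) (N : ℕ) :
    P.map (fun ω (k : Fin N) => B (t (k + 1)) ω - B (t k) ω) =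
      Measure.pi fun k : Fin N => Measure.pi fun _ : Fin l =>
        gaussianReal 0 (Real.toNNReal ((t (k + 1) : ℝ) - t k)) := by
  have hBm : ∀ s u, s ≤ u → Measurable[𝓕 u] fun ω => B u ω - B s ω := fun s u h =>
    Measurable.fun_sub (hB.adapted u) ((hB.adapted s).mono (𝓕.mono h) le_rfl)
  have hBm' : ∀ k, Measurable fun ω => B (t (k + 1)) ω - B (t k) ω := fun k =>
    (hBm _ _ (ht k.le_succ)).mono (𝓕.le _) le_rfl
  symm
  refine Measure.pi_eq fun s hs => ?_
  have hincm : Measurable fun ω (k : Fin N) => B (t (k + 1)) ω - B (t k) ω :=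
    measurable_pi_lambda _ fun k => hBm' k
  rw [Measure.map_apply hincm (MeasurableSet.univ_pi hs)]
  set s' : ℕ → Set (Fin l → ℝ) := fun k => if h : k < N then s ⟨k, h⟩ else Set.univ with hs'
  have hs'm : ∀ k, MeasurableSet (s' k) := fun k => by
    by_cases h : k < N
    · simpa only [hs', h, dif_pos] using hs _
    · simp only [hs', h, dif_neg, not_false_iff, MeasurableSet.univ]
  -- Measurability at time `t m` is carried along because independence of the next increment is from
  -- `𝓕 (t m)`.
  have main : ∀ m, MeasurableSet[𝓕 (t m)]
        {ω | ∀ k < m, B (t (k + 1)) ω - B (t k) ω ∈ s' k} ∧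
      P {ω | ∀ k < m, B (t (k + 1)) ω - B (t k) ω ∈ s' k} =
        ∏ k ∈ Finset.range m, (Measure.pi fun _ : Fin l =>
          gaussianReal 0 (Real.toNNReal ((t (k + 1) : ℝ) - t k))) (s' k) := by
    intro m
    induction m with
    | zero => simp
    | succ m ih =>
      have e : {ω | ∀ k < m + 1, B (t (k + 1)) ω - B (t k) ω ∈ s' k} =
          (fun ω => B (t (m + 1)) ω - B (t m) ω) ⁻¹' (s' m) ∩
            {ω | ∀ k < m, B (t (k + 1)) ω - B (t k) ω ∈ s' k} := by
        ext ω; simp only [Nat.forall_lt_succ_right]; exact and_comm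
      rw [e]
      refine ⟨MeasurableSet.inter (hBm _ _ (ht m.le_succ) (hs'm m))
        (𝓕.mono (ht m.le_succ) _ ih.1), ?_⟩
      rw [(Indep_iff _ _ _).1 (hB.indep _ _ (ht m.le_succ)) _ _ ⟨s' m, hs'm m, rfl⟩ ih.1, ih.2,
        Finset.prod_range_succ, mul_comm, ← (hB.law _ _ (ht m.le_succ)).map_eq,
        Measure.map_apply (hBm' m) (hs'm m)]
  have e : (fun ω (k : Fin N) => B (t (k + 1)) ω - B (t k) ω) ⁻¹' Set.univ.pi s =
      {ω | ∀ k < N, B (t (k + 1)) ω - B (t k) ω ∈ s' k} := by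
    ext ω
    simp only [Set.mem_preimage, Set.mem_univ_pi, Set.mem_ofPred_eq, Fin.forall_iff]
    refine forall₂_congr fun k hk => ?_
    simp only [hs', hk, dif_pos]
  rw [e, (main N).2, ← Fin.prod_univ_eq_prod_range
    (fun k => (Measure.pi fun _ : Fin l =>
          gaussianReal 0 (Real.toNNReal ((t (k + 1) : ℝ) - t k))) (s' k))]
  refine Finset.prod_congr rfl fun k _ => ?_
  simp only [hs', k.isLt, dif_pos]

/-- The law of the logarithmic return over a period of length `v`. -/
noncomputable def logReturnLaw (Γ : Matrix (Fin l) (Fin l) ℝ) (v : NNReal) :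
    Measure (Fin l → ℝ) :=
  (Measure.pi fun _ : Fin l => gaussianReal 0 v).map
    fun z => Γ.mulVec z - fun i => (∑ j, Γ i j ^ 2) * v / 2

theorem measurable_mulVec_sub (Γ : Matrix (Fin l) (Fin l) ℝ) (a : Fin l → ℝ) :
    Measurable fun z => Γ.mulVec z - a := by
  unfold Matrix.mulVec dotProduct; fun_prop

instance (Γ : Matrix (Fin l) (Fin l) ℝ) (v : NNReal) :
    IsProbabilityMeasure (logReturnLaw Γ v) :=
  Measure.isProbabilityMeasure_map (measurable_mulVec_sub _ _).aemeasurable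

/-- The prices along a grid as a function of the logarithmic returns. -/
noncomputable def pricesOfReturns (x : Fin l → ℝ) (N : ℕ) (y : Fin N → Fin l → ℝ) :
    Fin (N + 1) → Fin l → ℝ :=
  fun k i => x i * Real.exp (∑ j : Fin N, if (j : ℕ) < k then y j i else 0)

/-- The logarithmic returns as a function of the prices along a grid. -/
noncomputable def returnsOfPrices (x : Fin l → ℝ) (N : ℕ) (w : Fin (N + 1) → Fin l → ℝ) :
    Fin N → Fin l → ℝ :=
  fun j i => Real.log (w j.succ i / x i) - Real.log (w j.castSucc i / x i)

theorem measurable_pricesOfReturns (x : Fin l → ℝ) (N : ℕ) :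
    Measurable (pricesOfReturns x N) := by
  refine measurable_pi_lambda _ fun k => measurable_pi_lambda _ fun i => ?_
  refine (Real.measurable_exp.comp (Finset.measurable_fun_sum _ fun j _ => ?_)).const_mul _
  split_ifs <;> fun_prop

theorem measurable_returnsOfPrices (x : Fin l → ℝ) (N : ℕ) :
    Measurable (returnsOfPrices x N) := by
  unfold returnsOfPrices; fun_prop

/-- Passing from returns to prices loses no information once `x` has no zero coordinate, so it will
preserve divergence. -/
theorem returnsOfPrices_pricesOfReturns (hx : ∀ i, x i ≠ 0) (N : ℕ) (y : Fin N → Fin l → ℝ) :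
    returnsOfPrices x N (pricesOfReturns x N y) = y := by
  ext k i
  simp only [returnsOfPrices, pricesOfReturns, mul_div_cancel_left₀ _ (hx i), Real.log_exp,
    ← Finset.sum_sub_distrib]
  -- The partial sums up to `k + 1` and up to `k` differ only in the term of index `k`.
  rw [Finset.sum_eq_single k]
  · simp
  · intro j _ hj
    have : (j : ℕ) ≠ k := fun h => hj (Fin.ext h)
    have : ((j : ℕ) < k.succ) ↔ ((j : ℕ) < k.castSucc) := by
      rw [Fin.val_succ, Fin.val_castSucc]; omega
    rw [if_congr this rfl rfl, sub_self]
  · simp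

/-- The law of a Black–Scholes model along a dyadic grid. -/
theorem IsBlackScholesModel.map_grid [IsProbabilityMeasure P]
    (hM : IsBlackScholesModel P 𝓕 B Γ x M) (n : ℕ) :
    P.map (fun ω (k : Fin (2 ^ n + 1)) => M ω (gridPoint (2 ^ n) k)) =
      (Measure.pi fun _ : Fin (2 ^ n) => logReturnLaw Γ ((2 : NNReal) ^ n)⁻¹).map
        (pricesOfReturns x (2 ^ n)) := by
  have hBm : ∀ t, Measurable (B t) := fun t => (hM.brownian.adapted t).mono (𝓕.le t) le_rfl
  have hstep : ∀ k < 2 ^ n, (dyadicTime n (k + 1) : ℝ) - dyadicTime n k = (2 ^ n : ℝ)⁻¹ := by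
    intro k hk
    have e : ∀ j ≤ 2 ^ n, (dyadicTime n j : ℝ) = (j : ℝ) / 2 ^ n := fun j hj => by
      refine min_eq_left ?_
      rw [div_le_one (by positivity)]
      exact_mod_cast hj
    rw [e _ hk, e _ hk.le]; push_cast; ring
  have hlaw := hM.brownian.map_increments (dyadicTime n) (dyadicTime_mono n) (2 ^ n)
  have hv : ∀ k : Fin (2 ^ n), Real.toNNReal ((dyadicTime n (k + 1) : ℝ) - dyadicTime n k) =
      ((2 : NNReal) ^ n)⁻¹ := fun k => by
    rw [hstep k k.isLt]
    ext
    rw [Real.coe_toNNReal _ (by positivity)]; push_cast; rfl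
  simp only [hv] at hlaw
  have hincm : Measurable fun ω (k : Fin (2 ^ n)) =>
      B (dyadicTime n (k + 1)) ω - B (dyadicTime n k) ω :=
    measurable_pi_lambda _ fun k => (hBm _).sub (hBm _)
  have hT : Measurable fun (z : Fin (2 ^ n) → Fin l → ℝ) (k : Fin (2 ^ n)) =>
      Γ.mulVec (z k) - fun i => (∑ j, Γ i j ^ 2) * (((2 : NNReal) ^ n)⁻¹ : NNReal) / 2 :=
    measurable_pi_lambda _ fun k => (measurable_mulVec_sub _ _).comp (measurable_pi_apply k)
  unfold logReturnLaw
  rw [← Measure.pi_map_pi (fun _ => (measurable_mulVec_sub _ _).aemeasurable), ← hlaw,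
    Measure.map_map hT hincm,
    Measure.map_map (measurable_pricesOfReturns _ _) (hT.comp hincm)]
  refine Measure.map_congr ?_
  have hae : ∀ᵐ ω ∂P, ∀ (k : Fin (2 ^ n + 1)) (i : Fin l),
      M ω (dyadicTime n k) i = x i * Real.exp (Γ.mulVec (B (dyadicTime n k) ω) i -
      (∑ j, Γ i j ^ 2) * dyadicTime n k / 2) :=
    ae_all_iff.2 fun k => ae_all_iff.2 fun i => hM.ae_eq_exp n k i
  filter_upwards [hae, hM.brownian.zero] with ω hω h0
  ext k i
  rw [gridPoint_two_pow, hω k i]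
  simp only [Function.comp_apply, pricesOfReturns]
  congr 2
  -- `a` is the logarithmic price relative to `x i`; the returns are its increments, so their
  -- partial sums telescope.
  set a : ℕ → ℝ := fun j => Γ.mulVec (B (dyadicTime n j) ω) i -
    (∑ j, Γ i j ^ 2) * dyadicTime n j / 2 with ha
  have ha0 : a 0 = 0 := by simp [ha, dyadicTime_zero, h0]
  have hinc : ∀ j : Fin (2 ^ n), (if (j : ℕ) < k then
      (Γ.mulVec (B (dyadicTime n (j + 1)) ω - B (dyadicTime n j) ω) - fun i =>
        (∑ j, Γ i j ^ 2) * (((2 : NNReal) ^ n)⁻¹ : NNReal) / 2) i else 0) =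
      (fun j : ℕ => if j < k then a (j + 1) - a j else 0) j := by
    intro j
    have := hstep j j.isLt
    simp only [ha, Matrix.mulVec_sub, Pi.sub_apply]
    refine if_congr Iff.rfl ?_ rfl
    push_cast
    rw [← this]; ring
  rw [Finset.sum_congr rfl fun j _ => hinc j, Fin.sum_univ_eq_sum_range
    (fun j : ℕ => if j < k then a (j + 1) - a j else 0), ← Finset.sum_filter]
  have hfil : (Finset.range (2 ^ n)).filter (fun j => j < (k : ℕ)) = Finset.range k := by
    ext j; have := k.isLt; simp; omega
  rw [hfil, Finset.sum_range_sub, ha0, sub_zero]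

end Model

/-! ### Densities under push-forward and products -/

section WithDensity

variable {α β : Type*} {mα : MeasurableSpace α} {mβ : MeasurableSpace β}

theorem MeasureTheory.Measure.map_withDensity_comp (ν : Measure α) {T : α → β} (hT : Measurable T)
    {g : β → ℝ≥0∞} (hg : Measurable g) :
    (ν.withDensity (g ∘ T)).map T = (ν.map T).withDensity g := by
  ext s hs
  rw [Measure.map_apply hT hs, withDensity_apply _ (hT hs), withDensity_apply _ hs,
    setLIntegral_map hs hg hT]
  rfl

theorem MeasureTheory.lintegral_fin_prod_eq_prod {n : ℕ} (μ : Fin n → Measure α)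
    [∀ i, SigmaFinite (μ i)] {f : α → ℝ≥0∞} (hf : Measurable f) :
    ∫⁻ z, ∏ i, f (z i) ∂Measure.pi μ = ∏ i, ∫⁻ a, f a ∂μ i := by
  induction n with
  | zero => simp
  | succ n ih =>
    have h := (measurePreserving_piFinSuccAbove μ 0).symm.lintegral_comp
      (f := fun z => ∏ i, f (z i)) (by fun_prop)
    rw [← h]
    simp only [Fin.prod_univ_succ]
    have e : ∀ a : α × (Fin n → α),
        f ((MeasurableEquiv.piFinSuccAbove (fun _ : Fin (n + 1) => α) 0).symm a 0) *
          ∏ i : Fin n, f ((MeasurableEquiv.piFinSuccAbove (fun _ => α) 0).symm a i.succ) =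
        f a.1 * ∏ i, f (a.2 i) := fun a => by
      simp [MeasurableEquiv.piFinSuccAbove, Fin.insertNthEquiv]
    rw [lintegral_congr e, lintegral_prod_mul (g := fun z : Fin n → α => ∏ i, f (z i))
      hf.aemeasurable (Measurable.aemeasurable (by fun_prop)), ih]
    simp

theorem MeasureTheory.Measure.pi_fin_withDensity {n : ℕ} (μ : Measure α) [SigmaFinite μ]
    (f : α → ℝ≥0∞) (hf : Measurable f) [SigmaFinite (μ.withDensity f)] :
    (Measure.pi fun _ : Fin n => μ.withDensity f) =
      (Measure.pi fun _ : Fin n => μ).withDensity fun z => ∏ i, f (z i) := by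
  refine Measure.pi_eq fun s hs => ?_
  rw [withDensity_apply _ (MeasurableSet.univ_pi hs), Measure.restrict_pi_pi]
  simp only [withDensity_apply _ (hs _)]
  exact lintegral_fin_prod_eq_prod _ hf

end WithDensity

namespace InformationTheory

/-! ### Invariance and additivity of relative entropy -/

section General

variable {α β : Type*} {mα : MeasurableSpace α} {mβ : MeasurableSpace β}

/-- The Kullback–Leibler divergence is invariant under a map that generates the σ-algebra. -/
theorem klDiv_map_eq_of_eq_comap {f : α → β} (h : mα = mβ.comap f) (μ ν : Measure α)
    [IsFiniteMeasure μ] [IsFiniteMeasure ν] : klDiv (μ.map f) (ν.map f) = klDiv μ ν := by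
  have hf : Measurable f := by rw [h]; exact comap_measurable f
  by_cases hac : μ.map f ≪ ν.map f
  swap
  · rw [klDiv_of_not_ac hac, klDiv_of_not_ac fun hc => hac (hc.map hf)]
  set r := (μ.map f).rnDeriv (ν.map f) with hr
  have hrm : Measurable r := Measure.measurable_rnDeriv _ _
  -- Every measurable set is a preimage under `f`, so a density of the images pulls back to a
  -- density of `μ`.
  have hμ : μ = ν.withDensity (r ∘ f) := by
    ext s hs
    obtain ⟨t, ht, rfl⟩ : MeasurableSet[mβ.comap f] s := by rwa [← h]
    rw [withDensity_apply _ hs]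
    change _ = ∫⁻ a in f ⁻¹' t, r (f a) ∂ν
    rw [← setLIntegral_map ht hrm hf, Measure.setLIntegral_rnDeriv hac,
      Measure.map_apply hf ht]
  have hac' : μ ≪ ν := by rw [hμ]; exact withDensity_absolutelyContinuous _ _
  have hrn : μ.rnDeriv ν =ᵐ[ν] r ∘ f := by
    conv_lhs => rw [hμ]
    exact Measure.rnDeriv_withDensity _ (hrm.comp hf)
  rw [klDiv_eq_lintegral_klFun_of_ac hac, klDiv_eq_lintegral_klFun_of_ac hac',
    lintegral_map (by fun_prop) hf]
  refine lintegral_congr_ae ?_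
  filter_upwards [hrn] with a ha
  rw [ha]; rfl

/-- Data processing inequality applied to `f` and then to `g`. -/
theorem klDiv_map_eq_of_leftInverse {f : α → β} {g : β → α} (hf : Measurable f) (hg : Measurable g)
    (hgf : Function.LeftInverse g f) (μ ν : Measure α) [IsFiniteMeasure μ] [IsFiniteMeasure ν] :
    klDiv (μ.map f) (ν.map f) = klDiv μ ν := by
  refine le_antisymm (klDiv_map_le μ ν hf) ?_
  have h : ∀ ρ : Measure α, (ρ.map f).map g = ρ := fun ρ => by
    rw [Measure.map_map hg hf, hgf.comp_eq_id, Measure.map_id]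
  conv_lhs => rw [← h μ, ← h ν]
  exact klDiv_map_le _ _ hg

/-- Chain rule with constant kernels; the conditional term has the common factor `μ`, which drops
out after swapping coordinates. -/
theorem klDiv_prod (μ ν : Measure α) (κ η : Measure β) [IsProbabilityMeasure μ]
    [IsProbabilityMeasure ν] [IsProbabilityMeasure κ] [IsProbabilityMeasure η] :
    klDiv (μ.prod κ) (ν.prod η) = klDiv μ ν + klDiv κ η := by
  have h1 := klDiv_compProd_eq_add μ ν (Kernel.const α κ) (Kernel.const α η)
  have h2 := klDiv_compProd_left κ η (Kernel.const β μ)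
  simp only [Measure.compProd_const] at h1 h2
  rw [h1, ← h2]
  congr 1
  rw [← klDiv_map_eq_of_leftInverse measurable_swap measurable_swap Prod.swap_leftInverse
    (κ.prod μ) (η.prod μ), Measure.prod_swap, Measure.prod_swap]

theorem klDiv_pi_fin (μ ν : Measure α) [IsProbabilityMeasure μ] [IsProbabilityMeasure ν] (N : ℕ) :
    klDiv (Measure.pi fun _ : Fin N => μ) (Measure.pi fun _ : Fin N => ν) = N * klDiv μ ν := by
  induction N with
  | zero =>
    have h : (Measure.pi fun _ : Fin 0 => μ) = Measure.pi fun _ : Fin 0 => ν := by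
      rw [Measure.pi_of_empty, Measure.pi_of_empty]
    rw [h, klDiv_self]; simp
  | succ N ih =>
    have hμ := (measurePreserving_piFinSuccAbove (fun _ : Fin (N + 1) => μ) 0).map_eq
    have hν := (measurePreserving_piFinSuccAbove (fun _ : Fin (N + 1) => ν) 0).map_eq
    rw [← klDiv_map_eq_of_leftInverse
      (MeasurableEquiv.piFinSuccAbove (fun _ : Fin (N + 1) => α) 0).measurable
      (MeasurableEquiv.piFinSuccAbove (fun _ : Fin (N + 1) => α) 0).symm.measurable
      (MeasurableEquiv.piFinSuccAbove (fun _ : Fin (N + 1) => α) 0).left_inv, hμ, hν,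
      klDiv_prod, ih]
    push_cast; ring

end General

/-! ### Relative entropy of affine images of a Gaussian vector -/

section Gaussian

variable {l : ℕ} {v : NNReal}

theorem memLp_mulVec_add_pi_gaussianReal (A : Matrix (Fin l) (Fin l) ℝ) (m : Fin l → ℝ)
    (v : NNReal) (i : Fin l) :
    MemLp (fun z => (A.mulVec z + m) i) 2 (Measure.pi fun _ : Fin l => gaussianReal 0 v) ∧
    ∫ z, ((A.mulVec z + m) i) ^ 2 ∂(Measure.pi fun _ : Fin l => gaussianReal 0 v) =
      v * ∑ j, A i j ^ 2 + m i ^ 2 := by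
  have hφ : Measurable fun z : Fin l → ℝ => A.mulVec z i := by
    unfold Matrix.mulVec dotProduct; fun_prop
  have hmap : (Measure.pi fun _ : Fin l => gaussianReal 0 v).map (fun z => A.mulVec z i) =
      gaussianReal 0 (Real.toNNReal (∑ j, A i j ^ 2) * v) := map_sum_mul_pi_gaussianReal _ _
  set w := Real.toNNReal (∑ j, A i j ^ 2) * v with hw
  have hwr : (w : ℝ) = v * ∑ j, A i j ^ 2 := by
    rw [hw, NNReal.coe_mul, Real.coe_toNNReal _ (Finset.sum_nonneg fun j _ => sq_nonneg _),
      mul_comm]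
  have hid : MemLp (fun y : ℝ => y) 2 (gaussianReal 0 w) := memLp_id_gaussianReal 2
  have hL : MemLp (fun y : ℝ => y + m i) 2 (gaussianReal 0 w) := hid.add (memLp_const _)
  constructor
  · rw [← hmap] at hL
    exact (memLp_map_measure_iff hL.1 hφ.aemeasurable).1 hL
  · have h := integral_map (f := fun y : ℝ => (y + m i) ^ 2)
      (μ := Measure.pi fun _ : Fin l => gaussianReal 0 v) hφ.aemeasurable (by fun_prop)
    simp only [Pi.add_apply]
    rw [← h, hmap]
    have e : ∀ y : ℝ, (y + m i) ^ 2 = y ^ 2 + 2 * m i * y + m i ^ 2 := fun y => by ring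
    simp only [e]
    have i1 := hid.integrable_sq
    have i2 : Integrable (fun y : ℝ => 2 * m i * y) (gaussianReal 0 w) :=
      (hid.integrable (by norm_num)).const_mul _
    rw [integral_add (i1.fun_add i2) (integrable_const _), integral_add i1 i2,
      integral_const_mul, integral_sq_gaussianReal_zero, integral_id_gaussianReal, hwr]
    simp

theorem integral_sum_sq_mulVec_add_pi_gaussianReal (A : Matrix (Fin l) (Fin l) ℝ) (m : Fin l → ℝ)
    (v : NNReal) :
    Integrable (fun z => ∑ i, ((A.mulVec z + m) i) ^ 2)
      (Measure.pi fun _ : Fin l => gaussianReal 0 v) ∧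
    ∫ z, ∑ i, ((A.mulVec z + m) i) ^ 2 ∂(Measure.pi fun _ : Fin l => gaussianReal 0 v) =
      v * (∑ i, ∑ j, A i j ^ 2) + ∑ i, m i ^ 2 := by
  have hi := fun i => (memLp_mulVec_add_pi_gaussianReal A m v i).1.integrable_sq
  refine ⟨integrable_finsetSum _ fun i _ => hi i, ?_⟩
  rw [integral_finsetSum _ fun i _ => hi i]
  simp only [(memLp_mulVec_add_pi_gaussianReal A m v _).2, Finset.sum_add_distrib, Finset.mul_sum]

theorem pi_gaussianReal_eq_withDensity (hv : v ≠ 0) :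
    (Measure.pi fun _ : Fin l => gaussianReal 0 v) =
      (volume : Measure (Fin l → ℝ)).withDensity fun z => ENNReal.ofReal
        ((Real.sqrt (2 * Real.pi * v))⁻¹ ^ l * Real.exp (-(∑ i, z i ^ 2) / (2 * v))) := by
  have : SigmaFinite ((volume : Measure ℝ).withDensity (gaussianPDF 0 v)) := by
    rw [← gaussianReal_of_var_ne_zero 0 hv]; infer_instance
  rw [gaussianReal_of_var_ne_zero 0 hv, Measure.pi_fin_withDensity _ _ (measurable_gaussianPDF 0 v),
    volume_pi]
  congr 1
  ext z
  simp only [gaussianPDF]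
  rw [← ENNReal.ofReal_prod_of_nonneg fun i _ => gaussianPDFReal_nonneg _ _ _]
  simp only [gaussianPDFReal, Finset.prod_mul_distrib, Finset.prod_const, Finset.card_univ,
    Fintype.card_fin, sub_zero, ← Real.exp_sum, ← Finset.sum_div, Finset.sum_neg_distrib]

/-- The density of a nondegenerate affine image of a standard Gaussian vector with respect to that
vector. -/
theorem map_mulVec_add_pi_gaussianReal_eq_withDensity (hv : v ≠ 0)
    (A : Matrix (Fin l) (Fin l) ℝ) (hA : IsUnit A.det) (m : Fin l → ℝ) :
    (Measure.pi fun _ : Fin l => gaussianReal 0 v).map (fun z => A.mulVec z + m) =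
      (Measure.pi fun _ : Fin l => gaussianReal 0 v).withDensity fun y => ENNReal.ofReal
        (|A.det⁻¹| * Real.exp ((∑ i, y i ^ 2 - ∑ i, (A⁻¹.mulVec (y - m)) i ^ 2) / (2 * v))) := by
  set K : ℝ := (Real.sqrt (2 * Real.pi * v))⁻¹ ^ l with hK
  have hK0 : 0 ≤ K := by positivity
  have hmv : ∀ D : Matrix (Fin l) (Fin l) ℝ, Measurable fun z : Fin l → ℝ => D.mulVec z := by
    intro D; unfold Matrix.mulVec dotProduct; fun_prop
  set T : (Fin l → ℝ) → Fin l → ℝ := fun z => A.mulVec z + m with hT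
  set S : (Fin l → ℝ) → Fin l → ℝ := fun y => A⁻¹.mulVec (y - m) with hS
  have hTm : Measurable T := (hmv A).add_const m
  have hSm : Measurable S := (hmv A⁻¹).comp (measurable_id.sub_const m)
  have hST : ∀ z, S (T z) = z := fun z => by
    simp only [hS, hT, add_sub_cancel_right, Matrix.mulVec_mulVec, Matrix.nonsing_inv_mul _ hA,
      Matrix.one_mulVec]
  set φ : (Fin l → ℝ) → ℝ≥0∞ := fun z =>
    ENNReal.ofReal (K * Real.exp (-(∑ i, z i ^ 2) / (2 * v))) with hφ
  have hφm : Measurable φ := by simp only [hφ]; fun_prop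
  have hvol : (volume : Measure (Fin l → ℝ)).map T = ENNReal.ofReal |A.det⁻¹| • volume := by
    have h1 := Real.map_matrix_volume_pi_eq_smul_volume_pi hA.ne_zero
    have h2 : T = (fun y => y + m) ∘ (Matrix.toLin' A) := by
      ext z; simp [hT]
    have hAm : Measurable (Matrix.toLin' A) := hmv A
    have ham : Measurable fun y : Fin l → ℝ => y + m := by fun_prop
    rw [h2, ← Measure.map_map ham hAm, h1, Measure.map_smul, map_add_right_eq_self]
  have hγ := pi_gaussianReal_eq_withDensity (l := l) hv
  -- Writing the Gaussian density as a function of `T` lets it be pushed forward together with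
  -- Lebesgue measure.
  have hφ' : φ = (φ ∘ S) ∘ T := by ext z; simp only [Function.comp_apply, hST]
  have hdm : Measurable fun y : Fin l → ℝ => ENNReal.ofReal
        (|A.det⁻¹| * Real.exp ((∑ i, y i ^ 2 - ∑ i, (S y) i ^ 2) / (2 * v))) := by fun_prop
  change Measure.map T _ = _
  rw [hγ]
  change (volume.withDensity φ).map T = (volume.withDensity φ).withDensity _
  rw [← withDensity_mul _ hφm hdm, hφ', Measure.map_withDensity_comp _ hTm (hφm.comp hSm), hvol,
    withDensity_smul_measure, ← withDensity_smul _ (hφm.comp hSm), ← hφ']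
  congr 1
  ext y
  simp only [Pi.smul_apply, Pi.mul_apply, Function.comp_apply, hφ, smul_eq_mul]
  rw [← ENNReal.ofReal_mul (abs_nonneg _), ← ENNReal.ofReal_mul (by positivity)]
  congr 1
  have : Real.exp (-(∑ i, S y i ^ 2) / (2 * v)) = Real.exp (-(∑ i, y i ^ 2) / (2 * v)) *
      Real.exp ((∑ i, y i ^ 2 - ∑ i, (S y) i ^ 2) / (2 * v)) := by
    rw [← Real.exp_add]; congr 1; ring
  rw [this]; ring

/-- Along `T z` the log-density is `-(1/2) log (det A)²` plus `(|Az + m|² - |z|²) / (2v)`, whose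
mean follows from second moments. Nonnegativity is recorded because `ENNReal.ofReal` truncates; it
comes from that of the divergence itself. -/
theorem klDiv_map_mulVec_add_pi_gaussianReal (hv : v ≠ 0)
    (A : Matrix (Fin l) (Fin l) ℝ) (hA : IsUnit A.det) (m : Fin l → ℝ) :
    0 ≤ 1 / 2 * ((∑ i, ∑ j, A i j ^ 2) - l - Real.log (A.det ^ 2) + (∑ i, m i ^ 2) / v) ∧
    klDiv ((Measure.pi fun _ : Fin l => gaussianReal 0 v).map (fun z => A.mulVec z + m))
      (Measure.pi fun _ : Fin l => gaussianReal 0 v) = ENNReal.ofReal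
        (1 / 2 * ((∑ i, ∑ j, A i j ^ 2) - l - Real.log (A.det ^ 2) + (∑ i, m i ^ 2) / v)) := by
  set γ := Measure.pi fun _ : Fin l => gaussianReal 0 v with hγ
  set T : (Fin l → ℝ) → Fin l → ℝ := fun z => A.mulVec z + m with hT
  have hTm : Measurable T := by
    simp only [hT]; unfold Matrix.mulVec dotProduct; fun_prop
  set ρ : (Fin l → ℝ) → ℝ := fun y =>
    |A.det⁻¹| * Real.exp ((∑ i, y i ^ 2 - ∑ i, (A⁻¹.mulVec (y - m)) i ^ 2) / (2 * v)) with hρ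
  have hρm : Measurable ρ := by
    simp only [hρ]; unfold Matrix.mulVec dotProduct; fun_prop
  have hden : γ.map T = γ.withDensity fun y => ENNReal.ofReal (ρ y) :=
    map_mulVec_add_pi_gaussianReal_eq_withDensity hv A hA m
  have : IsProbabilityMeasure (γ.map T) := Measure.isProbabilityMeasure_map hTm.aemeasurable
  have hac : γ.map T ≪ γ := by rw [hden]; exact withDensity_absolutelyContinuous _ _
  have hllr : llr (γ.map T) γ =ᵐ[γ.map T] fun y => Real.log (ρ y) := by
    refine hac.ae_le ?_
    have h : (γ.map T).rnDeriv γ =ᵐ[γ] fun y => ENNReal.ofReal (ρ y) := by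
      rw [hden]; exact Measure.rnDeriv_withDensity _ (by fun_prop)
    filter_upwards [h] with y hy
    have h0 : 0 ≤ ρ y := by simp only [hρ]; positivity
    rw [llr, hy, ENNReal.toReal_ofReal h0]
  have hvr : (v : ℝ) ≠ 0 := by exact_mod_cast hv
  have hlog : ∀ z, Real.log (ρ (T z)) = -(1 / 2 * Real.log (A.det ^ 2)) +
      (2 * (v : ℝ))⁻¹ * (∑ i, (A.mulVec z + m) i ^ 2 -
        ∑ i, ((1 : Matrix (Fin l) (Fin l) ℝ).mulVec z + 0) i ^ 2) := by
    intro z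
    have hST : A⁻¹.mulVec (T z - m) = z := by
      simp only [hT, add_sub_cancel_right, Matrix.mulVec_mulVec, Matrix.nonsing_inv_mul _ hA,
        Matrix.one_mulVec]
    have hd : |A.det⁻¹| ≠ 0 := abs_ne_zero.2 (inv_ne_zero hA.ne_zero)
    simp only [hρ, hST]
    rw [Real.log_mul hd (Real.exp_ne_zero _), Real.log_exp, Real.log_abs, Real.log_inv,
      Real.log_pow, Matrix.one_mulVec, add_zero]
    simp only [hT]; push_cast; ring
  obtain ⟨i1, e1⟩ := integral_sum_sq_mulVec_add_pi_gaussianReal A m v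
  obtain ⟨i2, e2⟩ :=
    integral_sum_sq_mulVec_add_pi_gaussianReal (1 : Matrix (Fin l) (Fin l) ℝ) 0 v
  have hone : ∑ i : Fin l, ∑ j, (1 : Matrix (Fin l) (Fin l) ℝ) i j ^ 2 = l := by
    simp [Matrix.one_apply]
  have i3 : Integrable (fun z => (2 * (v : ℝ))⁻¹ * (∑ i, (A.mulVec z + m) i ^ 2 -
      ∑ i, ((1 : Matrix (Fin l) (Fin l) ℝ).mulVec z + 0) i ^ 2)) γ := (i1.sub i2).const_mul _
  have hint : Integrable (fun z => Real.log (ρ (T z))) γ := by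
    simp only [hlog]
    exact (integrable_const _).add i3
  have hlm : AEStronglyMeasurable (fun y => Real.log (ρ y)) (γ.map T) :=
    (Real.measurable_log.comp hρm).aestronglyMeasurable
  have hint' : Integrable (llr (γ.map T) γ) (γ.map T) := by
    refine Integrable.congr ?_ hllr.symm
    exact (integrable_map_measure hlm hTm.aemeasurable).2 hint
  have hval : ∫ y, llr (γ.map T) γ y ∂(γ.map T) + γ.real Set.univ - (γ.map T).real Set.univ =
      1 / 2 * ((∑ i, ∑ j, A i j ^ 2) - l - Real.log (A.det ^ 2) + (∑ i, m i ^ 2) / v) := by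
    rw [integral_congr_ae hllr, integral_map hTm.aemeasurable hlm]
    simp only [hlog]
    rw [integral_add (integrable_const _) i3, integral_const_mul, integral_sub i1 i2, e1, e2, hone]
    simp
    field_simp
    ring
  rw [klDiv_of_ac_of_integrable hac hint', ← hval]
  exact ⟨integral_llr_add_sub_measure_univ_nonneg hac hint', rfl⟩

/-- For `u ≠ 0` in the left kernel of `A`, the image lies in the hyperplane `u ⬝ᵥ y = u ⬝ᵥ m`. This
is null for the Gaussian, under which `u ⬝ᵥ y` has positive variance. -/
theorem klDiv_map_mulVec_add_pi_gaussianReal_eq_top (hv : v ≠ 0)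
    (A : Matrix (Fin l) (Fin l) ℝ) (hA : ¬ IsUnit A.det) (m : Fin l → ℝ) :
    klDiv ((Measure.pi fun _ : Fin l => gaussianReal 0 v).map (fun z => A.mulVec z + m))
      (Measure.pi fun _ : Fin l => gaussianReal 0 v) = ∞ := by
  set γ := Measure.pi fun _ : Fin l => gaussianReal 0 v with hγ
  have hTm : Measurable fun z : Fin l → ℝ => A.mulVec z + m := by
    unfold Matrix.mulVec dotProduct; fun_prop
  obtain ⟨u, hu, huA⟩ := Matrix.exists_vecMul_eq_zero_iff.2 (by simpa using hA)
  have hum : Measurable fun z : Fin l → ℝ => ∑ j, u j * z j := by fun_prop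
  refine klDiv_of_not_ac fun hac => ?_
  have hw : Real.toNNReal (∑ j, u j ^ 2) * v ≠ 0 := by
    refine mul_ne_zero (fun h => hu ?_) hv
    rw [Real.toNNReal_eq_zero] at h
    ext j
    have := (Finset.sum_eq_zero_iff_of_nonneg fun j _ => sq_nonneg (u j)).1
      (le_antisymm h (Finset.sum_nonneg fun j _ => sq_nonneg _)) j (Finset.mem_univ j)
    simpa using this
  have : NullSingletonClass (gaussianReal 0 (Real.toNNReal (∑ j, u j ^ 2) * v)) :=
    nullSingletonClass_gaussianReal hw
  set s : Set (Fin l → ℝ) := (fun z => ∑ j, u j * z j) ⁻¹' {∑ j, u j * m j} with hs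
  have hsm : MeasurableSet s := hum (measurableSet_singleton _)
  have h0 : γ s = 0 := by
    rw [hs, ← Measure.map_apply hum (measurableSet_singleton _), map_sum_mul_pi_gaussianReal]
    exact measure_singleton _
  have h1 := hac h0
  rw [Measure.map_apply hTm hsm] at h1
  have huniv : (fun z => A.mulVec z + m) ⁻¹' s = Set.univ := by
    refine Set.eq_univ_of_forall fun z => ?_
    have e : u ⬝ᵥ (A.mulVec z + m) = u ⬝ᵥ m := by
      rw [dotProduct_add, Matrix.dotProduct_mulVec, huA, zero_dotProduct, zero_add]
    exact e
  rw [huniv, measure_univ] at h1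
  exact one_ne_zero h1

end Gaussian

end InformationTheory

/-! ### Specific relative entropy of the two models -/

open InformationTheory in
-- The affine bijection that undoes the second return map whitens the second law. The first law
-- keeps a mean of order `v`, from the difference of the Itô corrections.
theorem klDiv_logReturnLaw {l : ℕ} (Γ₁ Γ₂ : Matrix (Fin l) (Fin l) ℝ) (hΓ₂ : IsUnit Γ₂.det)
    (v : NNReal) :
    klDiv (logReturnLaw Γ₁ v) (logReturnLaw Γ₂ v) =
      klDiv ((Measure.pi fun _ : Fin l => gaussianReal 0 v).map fun z =>
          (Γ₂⁻¹ * Γ₁).mulVec z + ((v : ℝ) / 2) •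
            Γ₂⁻¹.mulVec fun i => (∑ j, Γ₂ i j ^ 2) - ∑ j, Γ₁ i j ^ 2)
        (Measure.pi fun _ : Fin l => gaussianReal 0 v) := by
  set γ := Measure.pi fun _ : Fin l => gaussianReal 0 v with hγ
  set d : Matrix (Fin l) (Fin l) ℝ → Fin l → ℝ := fun Γ i => (∑ j, Γ i j ^ 2) * v / 2 with hd
  have hmv : ∀ D : Matrix (Fin l) (Fin l) ℝ, Measurable fun z : Fin l → ℝ => D.mulVec z := by
    intro D; unfold Matrix.mulVec dotProduct; fun_prop
  set S : (Fin l → ℝ) → Fin l → ℝ := fun y => Γ₂⁻¹.mulVec (y + d Γ₂) with hS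
  have hSm : Measurable S := (hmv Γ₂⁻¹).comp (measurable_id.add_const _)
  have hT : ∀ Γ, Measurable fun z => Γ.mulVec z - d Γ := fun Γ => measurable_mulVec_sub Γ _
  have hleft : Function.LeftInverse (fun z => Γ₂.mulVec z - d Γ₂) S := fun y => by
    simp only [hS, Matrix.mulVec_mulVec, Matrix.mul_nonsing_inv _ hΓ₂, Matrix.one_mulVec,
      add_sub_cancel_right]
  rw [← klDiv_map_eq_of_leftInverse hSm (hT Γ₂) hleft]
  have h1 : ∀ Γ, (logReturnLaw Γ v).map S = γ.map fun z => S (Γ.mulVec z - d Γ) := fun Γ =>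
    Measure.map_map hSm (hT Γ)
  have h2 : (fun z => S (Γ₂.mulVec z - d Γ₂)) = id := by
    ext1 z
    simp only [hS, Matrix.mulVec_mulVec, Matrix.nonsing_inv_mul _ hΓ₂, Matrix.one_mulVec,
      sub_add_cancel, id]
  rw [h1, h1, h2, Measure.map_id]
  congr 2
  ext1 z
  simp only [hS]
  rw [← Matrix.mulVec_mulVec, ← Matrix.mulVec_smul, ← Matrix.mulVec_add]
  congr 1
  ext i
  simp only [Pi.add_apply, Pi.sub_apply, Pi.smul_apply, smul_eq_mul, hd]
  ring

open InformationTheory in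
/-- The entropy on a grid is the divergence of the joint laws at the grid points. -/
theorem gridEntropy_eq_klDiv_map {l : ℕ} (Q P : Measure (PathSpace l)) [IsFiniteMeasure Q]
    [IsFiniteMeasure P] (n : ℕ) :
    gridEntropy Q P n = klDiv (Q.map fun ω (k : Fin (n + 1)) => ω (gridPoint n k))
      (P.map fun ω (k : Fin (n + 1)) => ω (gridPoint n k)) := by
  have hcomap : gridSigma l n = MeasurableSpace.comap
      (fun (ω : PathSpace l) (k : Fin (n + 1)) => ω (gridPoint n k)) MeasurableSpace.pi := by
    unfold gridSigma MeasurableSpace.pi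
    simp only [MeasurableSpace.comap_iSup, MeasurableSpace.comap_comp]
    rfl
  have hmap : ∀ R : Measure (PathSpace l),
      @Measure.map _ _ (gridSigma l n) _
        (fun (ω : PathSpace l) (k : Fin (n + 1)) => ω (gridPoint n k))
        (R.trim (gridSigma_le l n)) =
      R.map fun (ω : PathSpace l) (k : Fin (n + 1)) => ω (gridPoint n k) := fun R => by
    have hm : Measurable[gridSigma l n]
        fun (ω : PathSpace l) (k : Fin (n + 1)) => ω (gridPoint n k) := by
      rw [hcomap]; exact comap_measurable _
    rw [trim_eq_map, Measure.map_map hm (measurable_id'' (gridSigma_le l n))]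
    rfl
  rw [gridEntropy, ← klDiv_map_eq_of_eq_comap hcomap, hmap, hmap]

open InformationTheory in
-- Tensorisation over the `2 ^ n` i.i.d. returns cancels the factor `2⁻ⁿ` exactly.
theorem specificRelEntropy_eq_liminf_klDiv_logReturnLaw {l : ℕ} {Ω₁ Ω₂ : Type*}
    {mΩ₁ : MeasurableSpace Ω₁} {mΩ₂ : MeasurableSpace Ω₂}
    {P₁ : Measure Ω₁} [IsProbabilityMeasure P₁] {P₂ : Measure Ω₂} [IsProbabilityMeasure P₂]
    {𝓕₁ : Filtration I mΩ₁} {𝓕₂ : Filtration I mΩ₂}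
    {B₁ : I → Ω₁ → Fin l → ℝ} {B₂ : I → Ω₂ → Fin l → ℝ}
    {M₁ : Ω₁ → PathSpace l} {M₂ : Ω₂ → PathSpace l}
    {Γ₁ Γ₂ : Matrix (Fin l) (Fin l) ℝ} {x : Fin l → ℝ} (hx : ∀ i, x i ≠ 0)
    (h₁ : IsBlackScholesModel P₁ 𝓕₁ B₁ Γ₁ x M₁) (h₂ : IsBlackScholesModel P₂ 𝓕₂ B₂ Γ₂ x M₂) :
    specificRelEntropy (P₁.map M₁) (P₂.map M₂) = liminf (fun n : ℕ =>
      klDiv (logReturnLaw Γ₁ ((2 : NNReal) ^ n)⁻¹) (logReturnLaw Γ₂ ((2 : NNReal) ^ n)⁻¹))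
      atTop := by
  have : IsProbabilityMeasure (P₁.map M₁) :=
    Measure.isProbabilityMeasure_map h₁.measurable.aemeasurable
  have : IsProbabilityMeasure (P₂.map M₂) :=
    Measure.isProbabilityMeasure_map h₂.measurable.aemeasurable
  rw [specificRelEntropy]
  congr 1
  ext n
  have hg : Measurable fun (ω : PathSpace l) (k : Fin (2 ^ n + 1)) => ω (gridPoint (2 ^ n) k) :=
    measurable_pi_lambda _ fun k => (comap_measurable
      (fun ω : PathSpace l => ω (gridPoint (2 ^ n) k))).mono
        (le_iSup (fun t : I => MeasurableSpace.comap (fun ω : PathSpace l => ω t) inferInstance)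
          (gridPoint (2 ^ n) k)) le_rfl
  have e₁ := h₁.map_grid n
  have e₂ := h₂.map_grid n
  rw [gridEntropy_eq_klDiv_map, Measure.map_map hg h₁.measurable, Measure.map_map hg h₂.measurable]
  change _ * klDiv (P₁.map fun ω (k : Fin (2 ^ n + 1)) => M₁ ω (gridPoint (2 ^ n) k))
    (P₂.map fun ω (k : Fin (2 ^ n + 1)) => M₂ ω (gridPoint (2 ^ n) k)) = _
  rw [e₁, e₂, klDiv_map_eq_of_leftInverse (measurable_pricesOfReturns x _)
    (measurable_returnsOfPrices x _) (returnsOfPrices_pricesOfReturns hx _), klDiv_pi_fin,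
    ← mul_assoc]
  push_cast
  rw [ENNReal.inv_mul_cancel (by positivity) (by finiteness), one_mul]

theorem sum_sq_inv_mul_eq_trace {l : ℕ} (Γ₁ Γ₂ : Matrix (Fin l) (Fin l) ℝ) :
    ∑ i, ∑ j, (Γ₂⁻¹ * Γ₁) i j ^ 2 =
      ((Γ₂ * Γ₂.transpose)⁻¹ * (Γ₁ * Γ₁.transpose)).trace := by
  have h : ∑ i, ∑ j, (Γ₂⁻¹ * Γ₁) i j ^ 2 =
      ((Γ₂⁻¹ * Γ₁) * (Γ₂⁻¹ * Γ₁).transpose).trace := by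
    simp only [Matrix.trace, Matrix.diag, Matrix.mul_apply (M := Γ₂⁻¹ * Γ₁),
      Matrix.transpose_apply, sq]
  rw [h, Matrix.transpose_mul, Matrix.mul_inv_rev, Matrix.transpose_nonsing_inv, ← Matrix.mul_assoc,
    Matrix.trace_mul_comm]
  simp only [Matrix.mul_assoc]

theorem det_inv_mul_sq {l : ℕ} (Γ₁ Γ₂ : Matrix (Fin l) (Fin l) ℝ) :
    (Γ₂⁻¹ * Γ₁).det ^ 2 = (Γ₁ * Γ₁.transpose).det / (Γ₂ * Γ₂.transpose).det := by
  rw [Matrix.det_mul, Matrix.det_mul, Matrix.det_mul, Matrix.det_transpose, Matrix.det_transpose,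
    Matrix.det_nonsing_inv, Ring.inverse_eq_inv']
  rw [mul_pow, inv_pow, div_eq_mul_inv]; ring

theorem lemma1p4 {l : ℕ} {Ω₁ Ω₂ : Type*} {mΩ₁ : MeasurableSpace Ω₁} {mΩ₂ : MeasurableSpace Ω₂}
    (P₁ : Measure Ω₁) [IsProbabilityMeasure P₁] (P₂ : Measure Ω₂) [IsProbabilityMeasure P₂]
    (𝓕₁ : Filtration I mΩ₁) (𝓕₂ : Filtration I mΩ₂)
    (B₁ : I → Ω₁ → Fin l → ℝ) (B₂ : I → Ω₂ → Fin l → ℝ)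
    (M₁ : Ω₁ → PathSpace l) (M₂ : Ω₂ → PathSpace l)
    (Γ₁ Γ₂ : Matrix (Fin l) (Fin l) ℝ) (hΓ₂ : IsUnit Γ₂.det)
    (x : Fin l → ℝ) (hx : ∀ i, x i ≠ 0)
    (h₁ : IsBlackScholesModel P₁ 𝓕₁ B₁ Γ₁ x M₁) (h₂ : IsBlackScholesModel P₂ 𝓕₂ B₂ Γ₂ x M₂) :
    (IsUnit Γ₁.det →
      ((specificRelEntropy (P₁.map M₁) (P₂.map M₂) : ℝ≥0∞) : EReal) =
        (((1 / 2 : ℝ) *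
          (((Γ₂ * Γ₂.transpose)⁻¹ * (Γ₁ * Γ₁.transpose)).trace - (l : ℝ)
            - Real.log ((Γ₁ * Γ₁.transpose).det / (Γ₂ * Γ₂.transpose).det)) : ℝ) : EReal)) ∧
    (¬ IsUnit Γ₁.det → specificRelEntropy (P₁.map M₁) (P₂.map M₂) = ⊤) := by
  have hv : ∀ n : ℕ, ((2 : NNReal) ^ n)⁻¹ ≠ 0 := fun n => by positivity
  have hdet : (Γ₂⁻¹ * Γ₁).det = Γ₂.det⁻¹ * Γ₁.det := by
    rw [Matrix.det_mul, Matrix.det_nonsing_inv, Ring.inverse_eq_inv']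
  have hA : IsUnit (Γ₂⁻¹ * Γ₁).det ↔ IsUnit Γ₁.det := by
    rw [hdet, isUnit_iff_ne_zero, isUnit_iff_ne_zero]
    simp [hΓ₂.ne_zero]
  rw [specificRelEntropy_eq_liminf_klDiv_logReturnLaw hx h₁ h₂]
  simp only [klDiv_logReturnLaw Γ₁ Γ₂ hΓ₂]
  set w : Fin l → ℝ := Γ₂⁻¹.mulVec fun i => (∑ j, Γ₂ i j ^ 2) - ∑ j, Γ₁ i j ^ 2 with hw
  constructor
  · intro hΓ₁
    rw [← sum_sq_inv_mul_eq_trace, ← det_inv_mul_sq]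
    set a : ℝ := (∑ i, ∑ j, (Γ₂⁻¹ * Γ₁) i j ^ 2) - l - Real.log ((Γ₂⁻¹ * Γ₁).det ^ 2) with ha
    -- Taking `m = 0` isolates the covariance part; its sign is needed to remove the truncation in
    -- `ENNReal.ofReal`.
    have hC : 0 ≤ 1 / 2 * a := by
      have := (InformationTheory.klDiv_map_mulVec_add_pi_gaussianReal (v := 1) one_ne_zero _
        (hA.2 hΓ₁) 0).1
      simpa only [Pi.zero_apply, zero_pow two_ne_zero, Finset.sum_const_zero, zero_div, add_zero]
        using this
    -- With `m = (v / 2) • w` and `v = 2⁻ⁿ`, the mean term `|m|² / v` equals `2⁻ⁿ |w|² / 4`.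
    have hkl : ∀ n : ℕ, InformationTheory.klDiv
        ((Measure.pi fun _ : Fin l => gaussianReal 0 ((2 : NNReal) ^ n)⁻¹).map fun z =>
          (Γ₂⁻¹ * Γ₁).mulVec z + (((((2 : NNReal) ^ n)⁻¹ : NNReal) : ℝ) / 2) • w)
        (Measure.pi fun _ : Fin l => gaussianReal 0 ((2 : NNReal) ^ n)⁻¹) =
        ENNReal.ofReal (1 / 2 * (a + (1 / 2) ^ n * ((∑ i, w i ^ 2) / 4))) := by
      intro n
      rw [(InformationTheory.klDiv_map_mulVec_add_pi_gaussianReal (hv n) _ (hA.2 hΓ₁) _).2]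
      congr 2
      rw [ha]
      congr 1
      simp only [Pi.smul_apply, smul_eq_mul, mul_pow, ← Finset.mul_sum]
      push_cast
      rw [one_div_pow, one_div]
      field_simp
      ring
    simp only [hkl]
    have hpow : Tendsto (fun n : ℕ => (1 / 2 : ℝ) ^ n) atTop (nhds 0) :=
      tendsto_pow_atTop_nhds_zero_of_lt_one (by norm_num) (by norm_num)
    have hlim : Tendsto (fun n : ℕ => 1 / 2 * (a + (1 / 2) ^ n * ((∑ i, w i ^ 2) / 4))) atTop
        (nhds (1 / 2 * a)) := by
      have := ((hpow.mul_const ((∑ i, w i ^ 2) / 4)).const_add a).const_mul (1 / 2)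
      rwa [zero_mul, add_zero] at this
    have hlim' := (ENNReal.continuous_ofReal.tendsto _).comp hlim
    rw [Function.comp_def] at hlim'
    rw [hlim'.liminf_eq, EReal.coe_ennreal_ofReal, max_eq_left hC]
  · intro hΓ₁
    simp only [InformationTheory.klDiv_map_mulVec_add_pi_gaussianReal_eq_top (hv _) _
      (fun h => hΓ₁ (hA.1 h))]
    exact liminf_const _
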